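/- Let $\mathbf{Top}$ be the category of compactly generated spaces, i.e. spaces whose topology is coinduced by the continuous maps from compact Hausdorff spaces. For a small category $\mathcal C$ and functors $F:\mathcal C^{\mathrm{op}}\to\mathbf{Top}$, $G:\mathcal C\to\mathbf{Top}$, let $F\otimes_{\mathcal C}G=\int^{c}F(c)\times G(c)$ be their coend in $\mathbf{Top}$. *Segal's category.* $\Gamma$ has objects $\underline n=\{1,\dots,n\}$, $n\ge 0$; a morphism $\underline m\to\underline n$ is an $m$-tuple of pairwise disjoint subsets of $\underline n$, and $(N_1,\dots,N_m)\circ(M_1,\dots,M_k)=(\bigcup_{j\in M_1}N_j,\dots,\bigcup_{j\in M_k}N_j)$. A $\Gamma$-space is a functor $A:\Gamma^{\mathrm{op}}\to\mathbf{Top}$ such that $A(\underline 0)$ is a one-point space. A based space $(X,*)$ defines a functor $X^-:\Gamma\to\mathbf{Top}$, $\underline n\mapsto X^n$; a morphism $(M_1,\dots,M_m):\underline m\to\underline n$ acts by $(x_i)\mapsto(y_j)$ with $y_j=x_i$ if $j\in M_i$ and $y_j=*$ if $j\notin\bigcup_i M_i$. Put $\underline A(X)=A\otimes_\Gamma X^-$.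 The $n$-th space of the Segal spectrum of $A$ is $\underline A(S^n)$, where $S^n$ is the based $n$-sphere. Segal's functor $\gamma:\Delta\to\Gamma$ takes $[m]$ to $\underline m$ and $\phi:[k]\to[m]$ to $\gamma(\phi)(i)=\{j\in\underline m\mid\phi(i-1)<j\le\phi(i)\}$, $i=1,\dots,k$. *Wreath products.* For a small category $\mathcal A$, the category $\Gamma\wr\mathcal A$ (resp. $\Delta\wr\mathcal A$) has as objects the tuples $(A_1,\dots,A_m)$, $m\ge 0$, of objects of $\mathcal A$; a morphism $(A_1,\dots,A_m)\to(B_1,\dots,B_n)$ consists of a morphism $\phi:\underline m\to\underline n$ of $\Gamma$ (resp. $\phi:[m]\to[n]$ of $\Delta$) and of morphisms $\phi_i^k:A_i\to B_k$ of $\mathcal A$ for all $i$ and all $k\in\phi(i)$ (resp. $k\in\gamma(\phi)(i)$), with the composition induced by that of $\mathcal A$. Let $\Theta_1=\Delta$ and $\Theta_n=\Delta\wr\Theta_{n-1}$ for $n\ge2$. Let $\alpha:\Gamma\wr\Gamma\to\Gamma$, $(\underline n_1,\dots,\underline n_k)\mapsto\underline{n_1+\dots+n_k}$, be given by disjoint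 sum. The assembly functors $\gamma_n:\Theta_n\to\Gamma$ are $\gamma_1=\gamma$ and, for $n\ge 2$, the composite $\gamma_n:\Delta\wr\Theta_{n-1}\xrightarrow{\gamma\wr\gamma_{n-1}}\Gamma\wr\Gamma\xrightarrow{\alpha}\Gamma$. *Realisation.* Let $\Theta_1^-:\Delta\to\mathbf{Top}$ be the functor $[m]\mapsto\Delta^m$ (standard topological simplex). For $n\ge2$ let $\delta:\Delta\times\Theta_{n-1}\to\Delta\wr\Theta_{n-1}$, $([m],S)\mapsto(S,\dots,S)$ ($m$ entries), be the diagonal functor, and let $\Theta_n^-:\Theta_n\to\mathbf{Top}$ take $T$ to $\delta^*\Theta_n[T]\otimes_{\Delta\times\Theta_{n-1}}(\Delta^-\times\Theta_{n-1}^-)$, where $\Theta_n[T]=\Theta_n(-,T)$ is regarded as a presheaf of discrete spaces. The geometric realisation of $X:\Theta_n^{\mathrm{op}}\to\mathbf{Top}$ is $|X|_{\Theta_n}=X\otimes_{\Theta_n}\Theta_n^-$. **Corollary.** For every $n\ge1$ and every $\Gamma$-space $A$ there is a homeomorphism $$|\gamma_n^*A|_{\Theta_n}\;\cong\;\underline A(S^n),$$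 where $\gamma_n^*A=A\circ\gamma_n^{\mathrm{op}}$, and these homeomorphisms can be chosen to be natural in $A$. -/

import Mathlib

open CategoryTheory Opposite Topology

universe u

namespace ThetaSpaces

/-! ### Compactly generated spaces -/

/-- The family of all compact Hausdorff spaces (of size `u`), used as test spaces. -/
abbrev compHausFamily (K : CompHaus.{u}) : Type u := K.toTop

/-- The category of compactly generated spaces: the full subcategory of topological spaces
whose topology is coinduced by the continuous maps from compact Hausdorff spaces. -/
abbrev CGTop : Type (u + 1) := GeneratedByTopCat.{u} compHausFamily.{u}

/-- Compact generation of the objects of `CGTop` is Mathlib's `UCompactlyGeneratedSpace`. -/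
theorem isGeneratedBy_iff_uCompactlyGeneratedSpace (Y : Type u) [TopologicalSpace Y] :
    IsGeneratedBy compHausFamily.{u} Y ↔ UCompactlyGeneratedSpace.{u} Y := by
  constructor
  · intro h
    refine uCompactlyGeneratedSpace_of_isOpen fun s hs ↦ ?_
    exact (IsGeneratedBy.isOpen_iff (X := compHausFamily.{u})).2 fun K f ↦ hs K f
  · intro h
    refine IsGeneratedBy.iff_le_generatedBy.2 ?_
    intro s hs
    refine UCompactlyGeneratedSpace.isOpen (X := Y) fun K f ↦ ?_
    exact (WithGeneratedByTopology.isOpen_iff (X := compHausFamily.{u})).1 hs f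

/-- The functor replacing the topology of a space by the associated compactly generated one. -/
noncomputable abbrev kify : TopCat.{u} ⥤ CGTop.{u} :=
  TopCat.toGeneratedByTopCat (X := compHausFamily.{u})

/-- The binary product of compactly generated spaces. -/
noncomputable def kProd : CGTop.{u} × CGTop.{u} ⥤ CGTop.{u} where
  obj P := kify.obj (TopCat.of (P.1 × P.2))
  map f := kify.map (TopCat.ofHom
    ⟨Prod.map f.1.hom f.2.hom, f.1.hom.hom.continuous.prodMap f.2.hom.hom.continuous⟩)

/-- A set, regarded as a discrete space. -/
noncomputable def discreteSpace : Type ⥤ CGTop.{u} :=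
  uliftFunctor.{u, 0} ⋙ TopCat.discrete.{u} ⋙ kify.{u}

/-! ### Tensor products of functors (coends) -/

section Tensor

variable {C : Type} [SmallCategory C]

/-- The identifications `(F(f)x, y) ∼ (x, G(f)y)` defining the tensor product `F ⊗_C G`. -/
inductive TensorRel (F : Cᵒᵖ ⥤ CGTop.{u}) (G : C ⥤ CGTop.{u}) :
    (Σ c : C, kProd.obj (F.obj (op c), G.obj c)) →
      (Σ c : C, kProd.obj (F.obj (op c), G.obj c)) → Prop
  | glue {c d : C} (f : c ⟶ d) (x : F.obj (op d)) (y : G.obj c) :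
      TensorRel F G
        ⟨c, (WithGeneratedByTopology.equiv (X := compHausFamily.{u})).symm ((F.map f.op).hom x, y)⟩
        ⟨d, (WithGeneratedByTopology.equiv (X := compHausFamily.{u})).symm (x, (G.map f).hom y)⟩

/-- The tensor product `F ⊗_C G`, i.e. the coend `∫^c F(c) × G(c)` in compactly generated spaces:
the quotient of the disjoint union of the spaces `F(c) × G(c)` by the equivalence relation
generated by `TensorRel`. -/
noncomputable def tensorObj (F : Cᵒᵖ ⥤ CGTop.{u}) (G : C ⥤ CGTop.{u}) : CGTop.{u} :=
  GeneratedByTopCat.of (Quot (TensorRel F G))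

/-- The map `F ⊗_C G → F' ⊗_C G` induced by a natural transformation `F → F'`. -/
noncomputable def tensorMap {F F' : Cᵒᵖ ⥤ CGTop.{u}} (a : F ⟶ F') (G : C ⥤ CGTop.{u}) :
    tensorObj F G ⟶ tensorObj F' G :=
  ObjectProperty.homMk (TopCat.ofHom
    { toFun := Quot.map
        (Sigma.map id fun c ↦ (kProd.map (X := (F.obj (op c), G.obj c))
          (Y := (F'.obj (op c), G.obj c)) (a.app (op c), 𝟙 (G.obj c))).hom)
        (by
          rintro _ _ ⟨f, x, y⟩
          have h : (a.app (op _)).hom ((F.map f.op).hom x) =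
              (F'.map f.op).hom ((a.app (op _)).hom x) :=
            ConcreteCategory.congr_hom (a.naturality f.op) x
          have := TensorRel.glue (F := F') (G := G) f ((a.app (op _)).hom x) y
          rw [← h] at this
          exact this)
      continuous_toFun := by
        refine continuous_quot_lift _ (continuous_quot_mk.comp ?_)
        exact Continuous.sigma_map fun c ↦ (kProd.map (X := (F.obj (op c), G.obj c))
          (Y := (F'.obj (op c), G.obj c)) (a.app (op c), 𝟙 (G.obj c))).hom.hom.continuous })

/-- The functor `F ↦ F ⊗_C G`. -/
noncomputable def tensor (G : C ⥤ CGTop.{u}) : (Cᵒᵖ ⥤ CGTop.{u}) ⥤ CGTop.{u} where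
  obj F := tensorObj F G
  map a := tensorMap a G
  map_id F := by
    ext x
    obtain ⟨y, rfl⟩ := Quot.exists_rep (r := TensorRel F G) x
    rfl
  map_comp {F F' F''} a b := by
    ext x
    obtain ⟨y, rfl⟩ := Quot.exists_rep (r := TensorRel F G) x
    rfl

end Tensor

/-! ### Segal's category `Γ` -/

/-- The objects `n̲ = {1, …, n}` of `Γ`. -/
structure Gam : Type where
  /-- The number `n` of elements of `n̲`, which is modelled by `Fin n`. -/
  card : ℕ

/-- A `Γ`-operator `m̲ → n̲`: an `m`-tuple of pairwise disjoint subsets of `n̲`. -/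
@[ext]
structure Gam.Hom (m n : Gam) : Type where
  /-- The subsets. -/
  sets : Fin m.card → Set (Fin n.card)
  /-- The subsets are pairwise disjoint. -/
  disj : Pairwise fun i j ↦ Disjoint (sets i) (sets j)

theorem Gam.Hom.eq_of_mem {m n : Gam} (f : Gam.Hom m n) {i j : Fin m.card} {k : Fin n.card}
    (hi : k ∈ f.sets i) (hj : k ∈ f.sets j) : i = j := by
  by_contra h
  exact Set.disjoint_left.1 (f.disj h) hi hj

instance : SmallCategory Gam where
  Hom := Gam.Hom
  id m := ⟨fun i ↦ {i}, fun i j h ↦ by simpa using h⟩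
  comp f g := ⟨fun i ↦ ⋃ j ∈ f.sets i, g.sets j, fun i i' h ↦ by
    refine Set.disjoint_left.2 fun l hl hl' ↦ h ?_
    simp only [Set.mem_iUnion, exists_prop] at hl hl'
    obtain ⟨j, hj, hl⟩ := hl
    obtain ⟨j', hj', hl'⟩ := hl'
    obtain rfl := g.eq_of_mem hl hl'
    exact f.eq_of_mem hj hj'⟩
  id_comp f := by ext; simp
  comp_id f := by ext; simp
  assoc f g h := by
    ext i l
    simp only [Set.mem_iUnion, exists_prop]
    constructor
    · rintro ⟨k, ⟨j, hj, hk⟩, hl⟩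
      exact ⟨j, hj, k, hk, hl⟩
    · rintro ⟨j, hj, k, hk, hl⟩
      exact ⟨k, ⟨j, hj, hk⟩, hl⟩

@[ext]
theorem Gam.hom_ext {m n : Gam} {f g : m ⟶ n} (h : ∀ i, f.sets i = g.sets i) : f = g :=
  Gam.Hom.ext (funext h)

theorem Gam.mem_id {m : Gam} {i k : Fin m.card} :
    k ∈ Gam.Hom.sets (𝟙 m) i ↔ k = i := Iff.rfl

theorem Gam.mem_comp {m n p : Gam} {f : m ⟶ n} {g : n ⟶ p} {i : Fin m.card} {l : Fin p.card} :
    l ∈ Gam.Hom.sets (f ≫ g) i ↔ ∃ j, j ∈ f.sets i ∧ l ∈ g.sets j := by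
  change (l ∈ ⋃ j ∈ f.sets i, g.sets j) ↔ _
  simp

/-- Segal's functor `γ : Δ → Γ`, with `γ([m]) = m̲` and
`γ(φ)(i) = {j | φ(i - 1) < j ≤ φ(i)}` for `i = 1, …, k`. The elements `i` of `k̲` and `j` of `m̲`
are the successors of elements of `Fin k` and `Fin m`. -/
def segal : SimplexCategory ⥤ Gam where
  obj X := ⟨X.len⟩
  map {X Y} φ :=
    { sets := fun i : Fin X.len ↦
        {j : Fin Y.len | φ.toOrderHom i.castSucc < j.succ ∧ j.succ ≤ φ.toOrderHom i.succ}
      disj := by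
        have key : ∀ i i' : Fin X.len, i < i' →
            φ.toOrderHom i.succ ≤ φ.toOrderHom i'.castSucc := fun i i' h ↦
          φ.toOrderHom.monotone (Fin.le_castSucc_iff.2 (Fin.succ_lt_succ_iff.2 h))
        intro i i' h
        refine Set.disjoint_left.2 fun j hj hj' ↦ ?_
        rcases lt_or_gt_of_ne h with h | h
        · exact absurd ((hj.2.trans (key _ _ h)).trans_lt hj'.1) (lt_irrefl _)
        · exact absurd ((hj'.2.trans (key _ _ h)).trans_lt hj.1) (lt_irrefl _) }
  map_id X := by
    refine Gam.hom_ext fun i ↦ ?_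
    ext j
    rw [Gam.mem_id]
    change Fin.castSucc (n := X.len) i < Fin.succ (n := X.len) j ∧
      Fin.succ (n := X.len) j ≤ Fin.succ (n := X.len) i ↔ @Eq (Fin X.len) j i
    rw [Fin.ext_iff]
    simp only [Fin.lt_def, Fin.le_def, Fin.val_castSucc, Fin.val_succ]
    omega
  map_comp {X Y Z} φ ψ := by
    refine Gam.hom_ext fun i ↦ ?_
    ext l
    rw [Gam.mem_comp]
    change ψ.toOrderHom (φ.toOrderHom (Fin.castSucc i)) < Fin.succ l ∧
      Fin.succ l ≤ ψ.toOrderHom (φ.toOrderHom (Fin.succ i)) ↔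
      ∃ j : Fin Y.len, (φ.toOrderHom (Fin.castSucc i) < j.succ ∧
        j.succ ≤ φ.toOrderHom (Fin.succ i)) ∧
        ψ.toOrderHom j.castSucc < Fin.succ l ∧ Fin.succ l ≤ ψ.toOrderHom j.succ
    constructor
    · rintro ⟨h1, h2⟩
      have key : ∀ t : Fin (Y.len + 1), Fin.succ l ≤ ψ.toOrderHom t →
          ∃ j : Fin Y.len, j.succ ≤ t ∧
            (ψ.toOrderHom j.castSucc < Fin.succ l ∧ Fin.succ l ≤ ψ.toOrderHom j.succ) ∧
            φ.toOrderHom (Fin.castSucc i) < j.succ := by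
        intro t
        induction t using Fin.induction with
        | zero =>
          intro ht
          exact absurd (h1.trans_le (ht.trans (ψ.toOrderHom.monotone (Fin.zero_le _))))
            (lt_irrefl _)
        | succ t ih =>
          intro ht
          by_cases h : Fin.succ l ≤ ψ.toOrderHom t.castSucc
          · obtain ⟨j, hj, hj'⟩ := ih h
            exact ⟨j, hj.trans (Fin.castSucc_lt_succ).le, hj'⟩
          · refine ⟨t, le_rfl, ⟨lt_of_not_ge h, ht⟩, ?_⟩
            by_contra h3
            exact absurd (h1.trans_le (ht.trans (ψ.toOrderHom.monotone (not_lt.1 h3))))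
              (lt_irrefl _)
      obtain ⟨j, hj, hj', hj''⟩ := key _ h2
      exact ⟨j, ⟨hj'', hj⟩, hj'⟩
    · rintro ⟨j, ⟨h1, h2⟩, h3, h4⟩
      refine ⟨lt_of_le_of_lt (ψ.toOrderHom.monotone ?_) h3,
        h4.trans (ψ.toOrderHom.monotone h2)⟩
      exact Fin.le_castSucc_iff.2 h1

/-! ### Wreath products -/

section Wreath

variable {B : Type} [SmallCategory B]

/-- The objects of the wreath product `B ≀ A` over a functor `G : B → Γ`: an object `b` of `B`
together with a tuple of objects of `A` indexed by the elements of `G(b)`. For `G = γ : Δ → Γ` this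
is `Δ ≀ A`, for `G = id_Γ` it is `Γ ≀ A`; in both cases the objects are the tuples
`(A_1, …, A_m)`, `m ≥ 0`. -/
structure Wreath (G : B ⥤ Gam) (A : Type) : Type where
  /-- The object of `B`. -/
  base : B
  /-- The tuple of objects of `A`. -/
  label : Fin (G.obj base).card → A

variable {G : B ⥤ Gam} {A : Type} [SmallCategory A]

/-- The operators `(φ; φ_1, …, φ_m) : (A_1, …, A_m) → (B_1, …, B_n)` of the wreath product: a
morphism `φ` of `B` and, for each `i`, a morphism `A[A_i] → ∏_{k ∈ G(φ)(i)} A[B_k]`, given by its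
components `A_i → B_k`. -/
structure Wreath.Hom (X Y : Wreath G A) : Type where
  /-- The morphism of `B`. -/
  base : X.base ⟶ Y.base
  /-- The components. -/
  label : ∀ i k, k ∈ (G.map base).sets i → (X.label i ⟶ Y.label k)

theorem Wreath.Hom.ext' {X Y : Wreath G A} {f g : Wreath.Hom X Y} (hb : f.base = g.base)
    (hl : ∀ i k (h : k ∈ (G.map f.base).sets i) (h' : k ∈ (G.map g.base).sets i),
      f.label i k h = g.label i k h') : f = g := by
  obtain ⟨fb, fl⟩ := f
  obtain ⟨gb, gl⟩ := g
  obtain rfl : fb = gb := hb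
  congr
  funext i k h
  exact hl i k h h

theorem Wreath.exists_mem {X Y Z : Wreath G A} {f : Wreath.Hom X Y} {g : Wreath.Hom Y Z}
    {i : Fin (G.obj X.base).card} {l : Fin (G.obj Z.base).card}
    (h : l ∈ (G.map (f.base ≫ g.base)).sets i) :
    ∃ j, j ∈ (G.map f.base).sets i ∧ l ∈ (G.map g.base).sets j := by
  rw [G.map_comp] at h
  exact Gam.mem_comp.1 h

/-- The composition of operators: the component `A_i → C_l` of a composite is the composite of the
components `A_i → B_j → C_l`, where `j` is the unique element of `G(φ)(i)` with `l ∈ G(ψ)(j)`. -/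
noncomputable def Wreath.Hom.comp {X Y Z : Wreath G A} (f : Wreath.Hom X Y)
    (g : Wreath.Hom Y Z) : Wreath.Hom X Z where
  base := f.base ≫ g.base
  label i l h :=
    f.label i (Wreath.exists_mem h).choose (Wreath.exists_mem h).choose_spec.1 ≫
      g.label (Wreath.exists_mem h).choose l (Wreath.exists_mem h).choose_spec.2

theorem Wreath.Hom.comp_label {X Y Z : Wreath G A} (f : Wreath.Hom X Y) (g : Wreath.Hom Y Z)
    {i : Fin (G.obj X.base).card} {j : Fin (G.obj Y.base).card} {l : Fin (G.obj Z.base).card}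
    (h : l ∈ (G.map (f.base ≫ g.base)).sets i)
    (hj : j ∈ (G.map f.base).sets i) (hl : l ∈ (G.map g.base).sets j) :
    (f.comp g).label i l h = f.label i j hj ≫ g.label j l hl := by
  have key : ∀ j' (hj' : j' ∈ (G.map f.base).sets i) (hl' : l ∈ (G.map g.base).sets j'),
      f.label i j' hj' ≫ g.label j' l hl' = f.label i j hj ≫ g.label j l hl := by
    intro j' hj' hl'
    obtain rfl := Gam.Hom.eq_of_mem _ hl hl'
    rfl
  exact key _ _ _

noncomputable instance : SmallCategory (Wreath G A) where
  Hom := Wreath.Hom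
  id X :=
    { base := 𝟙 X.base
      label := fun i k h ↦ eqToHom (by
        rw [G.map_id] at h
        rw [Gam.mem_id.1 h]) }
  comp f g := f.comp g
  id_comp {X Y} f := by
    refine Wreath.Hom.ext' (Category.id_comp _) fun i k h h' ↦ ?_
    rw [Wreath.Hom.comp_label (j := i) _ _ h (by rw [G.map_id]; exact Gam.mem_id.2 rfl) h']
    simp
  comp_id {X Y} f := by
    refine Wreath.Hom.ext' (Category.comp_id _) fun i k h h' ↦ ?_
    rw [Wreath.Hom.comp_label (j := k) _ _ h h' (by rw [G.map_id]; exact Gam.mem_id.2 rfl)]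
    simp
  assoc {W X Y Z} f g h := by
    refine Wreath.Hom.ext' (Category.assoc _ _ _) fun i l hl hl' ↦ ?_
    obtain ⟨k, hk, hkl⟩ := Wreath.exists_mem (f := f.comp g) (g := h) hl
    obtain ⟨j, hj, hjk⟩ := Wreath.exists_mem (f := f) (g := g) hk
    have hjl : l ∈ (G.map (g.base ≫ h.base)).sets j := by
      rw [G.map_comp]
      exact Gam.mem_comp.2 ⟨k, hjk, hkl⟩
    rw [Wreath.Hom.comp_label (f.comp g) h hl hk hkl, Wreath.Hom.comp_label f g hk hj hjk,
      Wreath.Hom.comp_label f (g.comp h) hl' hj hjl, Wreath.Hom.comp_label g h hjl hjk hkl,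
      Category.assoc]

/-- The functor `B ≀ A → Γ ≀ A`, `(φ; φ_1, …, φ_m) ↦ (G(φ); φ_1, …, φ_m)`. For `G = γ` this is the
functor `γ ≀ A : Δ ≀ A → Γ ≀ A`. -/
noncomputable def Wreath.toGam (G : B ⥤ Gam) (A : Type) [SmallCategory A] :
    Wreath G A ⥤ Wreath (𝟭 Gam) A where
  obj X := ⟨G.obj X.base, X.label⟩
  map f := Wreath.Hom.mk (G.map f.base) f.label
  map_id X := Wreath.Hom.ext' (G.map_id _) fun i k h h' ↦ rfl
  map_comp {X Y Z} f g := by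
    refine Wreath.Hom.ext' (G.map_comp _ _) fun i l h h' ↦ ?_
    obtain ⟨j, hj, hl⟩ := Wreath.exists_mem (f := f) (g := g) h
    refine (Wreath.Hom.comp_label f g h hj hl).trans ?_
    exact (Wreath.Hom.comp_label (G := 𝟭 Gam)
      (X := ⟨G.obj X.base, X.label⟩) (Y := ⟨G.obj Y.base, Y.label⟩) (Z := ⟨G.obj Z.base, Z.label⟩)
      (Wreath.Hom.mk (G.map f.base) f.label)
      (Wreath.Hom.mk (G.map g.base) g.label) h' hj hl).symm

/-- The functor `B ≀ F : B ≀ A → B ≀ A'` induced by a functor `F : A → A'`. -/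
noncomputable def Wreath.mapLabel (G : B ⥤ Gam) {A A' : Type} [SmallCategory A]
    [SmallCategory A'] (F : A ⥤ A') : Wreath G A ⥤ Wreath G A' where
  obj X := ⟨X.base, fun i ↦ F.obj (X.label i)⟩
  map f := Wreath.Hom.mk f.base fun i k h ↦ F.map (f.label i k h)
  map_id X := Wreath.Hom.ext' rfl fun i k h h' ↦ eqToHom_map F (by
    have h2 := h'
    erw [G.map_id] at h2
    rw [Gam.mem_id.1 h2])
  map_comp {X Y Z} f g := by
    refine Wreath.Hom.ext' rfl fun i l h h' ↦ ?_
    obtain ⟨j, hj, hl⟩ := Wreath.exists_mem (f := f) (g := g) h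
    refine (congrArg F.map (Wreath.Hom.comp_label f g h hj hl)).trans ?_
    rw [F.map_comp]
    exact (Wreath.Hom.comp_label (G := G)
      (X := ⟨X.base, fun i ↦ F.obj (X.label i)⟩) (Y := ⟨Y.base, fun i ↦ F.obj (Y.label i)⟩)
      (Z := ⟨Z.base, fun i ↦ F.obj (Z.label i)⟩)
      (Wreath.Hom.mk f.base fun i k h ↦ F.map (f.label i k h))
      (Wreath.Hom.mk g.base fun i k h ↦ F.map (g.label i k h)) h' hj hl).symm

end Wreath

/-- The functor `α : Γ ≀ Γ → Γ` with `α(n̲_1, …, n̲_k) = n̲` for `n = n_1 + ⋯ + n_k`, the disjoint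
sum: the elements of `α(n̲_1, …, n̲_k)` are the pairs `(i, s)` with `s ∈ n̲_i`, and an operator
`(φ; φ_1, …, φ_m)` goes to `(i, s) ↦ {(k, t) | k ∈ φ(i), t ∈ φ_i^k(s)}`. -/
noncomputable def disjointSum : Wreath (𝟭 Gam) Gam ⥤ Gam where
  obj X := ⟨∑ i : Fin X.base.card, (X.label i).card⟩
  map {X Y} f :=
    { sets := fun p : Fin (∑ i : Fin X.base.card, (X.label i).card) ↦
        {q : Fin (∑ k : Fin Y.base.card, (Y.label k).card) |
          ∃ h : (finSigmaFinEquiv.symm q).1 ∈ f.base.sets (finSigmaFinEquiv.symm p).1,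
            (finSigmaFinEquiv.symm q).2 ∈
              (f.label (finSigmaFinEquiv.symm p).1 (finSigmaFinEquiv.symm q).1 h).sets
                (finSigmaFinEquiv.symm p).2}
      disj := by
        intro p p' hp
        refine Set.disjoint_left.2 ?_
        rintro q ⟨h, hs⟩ ⟨h', hs'⟩
        apply hp
        apply finSigmaFinEquiv.symm.injective
        generalize finSigmaFinEquiv.symm p = P at *
        generalize finSigmaFinEquiv.symm p' = P' at *
        obtain ⟨i, s⟩ := P
        obtain ⟨i', s'⟩ := P'
        obtain rfl := Gam.Hom.eq_of_mem _ h h'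
        obtain rfl := Gam.Hom.eq_of_mem _ hs hs'
        rfl }
  map_id X := by
    refine Gam.hom_ext fun p ↦ ?_
    ext q
    rw [Gam.mem_id]
    refine Iff.trans ?_ (finSigmaFinEquiv.symm.injective.eq_iff (a := q) (b := p))
    change (∃ h : (finSigmaFinEquiv.symm q).1 ∈
        Gam.Hom.sets ((𝟭 Gam).map (𝟙 X.base)) (finSigmaFinEquiv.symm p).1,
      (finSigmaFinEquiv.symm q).2 ∈ Gam.Hom.sets (Wreath.Hom.label (𝟙 X) _ _ h) (finSigmaFinEquiv.symm p).2) ↔ _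
    generalize finSigmaFinEquiv.symm p = P at *
    generalize finSigmaFinEquiv.symm q = Q at *
    obtain ⟨i, s⟩ := P
    obtain ⟨k, t⟩ := Q
    constructor
    · rintro ⟨h, h'⟩
      obtain rfl := Gam.mem_id.1 h
      obtain rfl := Gam.mem_id.1 h'
      rfl
    · intro h
      cases h
      exact ⟨Gam.mem_id.2 rfl, Gam.mem_id.2 rfl⟩
  map_comp {X Y Z} f g := by
    refine Gam.hom_ext fun p ↦ ?_
    ext q
    rw [Gam.mem_comp]
    constructor
    · rintro ⟨h, hs⟩
      obtain ⟨j, hj, hl⟩ := Wreath.exists_mem (f := f) (g := g) h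
      have e := Wreath.Hom.comp_label f g h hj hl
      rw [show Wreath.Hom.label (f ≫ g) _ _ h = _ from e] at hs
      obtain ⟨r, hr, hr'⟩ := Gam.mem_comp.1 hs
      refine ⟨finSigmaFinEquiv (n := fun j ↦ (Y.label j).card) ⟨j, r⟩, ?_⟩
      change (∃ h : (finSigmaFinEquiv.symm (finSigmaFinEquiv (n := fun j ↦ (Y.label j).card) ⟨j, r⟩)).1 ∈ _, _) ∧
        (∃ h : _ ∈ g.base.sets (finSigmaFinEquiv.symm (finSigmaFinEquiv (n := fun j ↦ (Y.label j).card) ⟨j, r⟩)).1, _)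
      rw [Equiv.symm_apply_apply]
      exact ⟨⟨hj, hr⟩, ⟨hl, hr'⟩⟩
    · rintro ⟨r, ⟨hj, hr⟩, ⟨hl, hr'⟩⟩
      have h : (finSigmaFinEquiv.symm q).1 ∈
          Gam.Hom.sets ((𝟭 Gam).map (f.base ≫ g.base)) (finSigmaFinEquiv.symm p).1 :=
        Gam.mem_comp.2 ⟨_, hj, hl⟩
      refine ⟨h, ?_⟩
      have e := Wreath.Hom.comp_label f g h hj hl
      rw [show Wreath.Hom.label (f ≫ g) _ _ h = _ from e]
      exact Gam.mem_comp.2 ⟨_, hr, hr'⟩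

/-! ### The categories `Θ_n`, the assembly functors, and the realisation -/

/-- The diagonal `δ_A : Δ × A → Δ ≀ A`, `([m], a) ↦ (a, …, a)` (`m` times). -/
noncomputable def diag (A : Type) [SmallCategory A] : SimplexCategory × A ⥤ Wreath segal A where
  obj P := ⟨P.1, fun _ ↦ P.2⟩
  map f := Wreath.Hom.mk f.1 fun _ _ _ ↦ f.2
  map_id P := Wreath.Hom.ext' rfl fun i k h h' ↦ (eqToHom_refl P.2 rfl).symm
  map_comp {P Q R} f g := by
    refine Wreath.Hom.ext' rfl fun i l h h' ↦ ?_
    obtain ⟨j, hj, hl⟩ := Wreath.exists_mem (G := segal) (X := ⟨P.1, fun _ ↦ P.2⟩)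
      (Y := ⟨Q.1, fun _ ↦ Q.2⟩) (Z := ⟨R.1, fun _ ↦ R.2⟩)
      (f := Wreath.Hom.mk f.1 fun _ _ _ ↦ f.2) (g := Wreath.Hom.mk g.1 fun _ _ _ ↦ g.2) h
    exact (Wreath.Hom.comp_label (G := segal) (X := ⟨P.1, fun _ ↦ P.2⟩)
      (Y := ⟨Q.1, fun _ ↦ Q.2⟩) (Z := ⟨R.1, fun _ ↦ R.2⟩)
      (Wreath.Hom.mk f.1 fun _ _ _ ↦ f.2) (Wreath.Hom.mk g.1 fun _ _ _ ↦ g.2) h' hj hl).symm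

/-- `Θ_1 = Δ` and `Θ_n = Δ ≀ Θ_{n-1}` for `n ≥ 2` (and `Θ_0` is the one-point category). -/
noncomputable def Theta : ℕ → Cat.{0, 0}
  | 0 => Cat.of (Discrete PUnit)
  | 1 => Cat.of SimplexCategory
  | n + 2 => Cat.of (Wreath segal (Theta (n + 1)))

/-- The assembly functors: `γ_1 = γ : Δ → Γ`, and `γ_n` is the composite of
`γ ≀ γ_{n-1} : Δ ≀ Θ_{n-1} → Γ ≀ Γ` with `α : Γ ≀ Γ → Γ` for `n ≥ 2` (and `γ_0` takes the value
`1̲`). -/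
noncomputable def assembly : ∀ n : ℕ, Theta n ⥤ Gam
  | 0 => (Functor.const (Discrete PUnit)).obj ⟨1⟩
  | 1 => segal
  | n + 2 => Wreath.toGam segal (Theta (n + 1)) ⋙
      Wreath.mapLabel (𝟭 Gam) (assembly (n + 1)) ⋙ disjointSum

/-- The functor `Δ^- : Δ → Top`, `[m] ↦ Δ^m`. -/
noncomputable def simplexSpace : SimplexCategory ⥤ CGTop.{u} :=
  SimplexCategory.toTop.{u} ⋙ kify

/-- The realisation `X ↦ X ⊗_C G` of presheaves of sets on `C`, associated with `G : C → Top`. -/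
noncomputable def realizeSets {C : Type} [SmallCategory C] (G : C ⥤ CGTop.{u}) :
    (Cᵒᵖ ⥤ Type) ⥤ CGTop.{u} :=
  (Functor.whiskeringRight Cᵒᵖ Type CGTop.{u}).obj discreteSpace ⋙ tensor G

/-- The functor `Θ_n^- : Θ_n → Top`, `T ↦ |Θ_n[T]|_{Θ_n}`. For `n = 1` it is `[m] ↦ Δ^m`; for
`n ≥ 2` the realisation of a presheaf `X` on `Θ_n = Δ ≀ Θ_{n-1}` is
`|X|_{Θ_n} = |δ^*X|_{Δ × Θ_{n-1}}`, where `δ : Δ × Θ_{n-1} → Δ ≀ Θ_{n-1}` is the diagonal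
and the realisation of presheaves on `Δ × Θ_{n-1}` is the colimit preserving functor which takes
`Δ[m] × Θ_{n-1}[S]` to `Δ^m × |Θ_{n-1}[S]|_{Θ_{n-1}}`. -/
noncomputable def thetaCell : ∀ n : ℕ, Theta n ⥤ CGTop.{u}
  | 0 => (Functor.const (Discrete PUnit)).obj (kify.obj (TopCat.of PUnit))
  | 1 => simplexSpace
  | n + 2 =>
      (yoneda (C := Wreath segal (Theta (n + 1)))) ⋙
        (Functor.whiskeringLeft (SimplexCategory × Theta (n + 1))ᵒᵖ
          (Wreath segal (Theta (n + 1)))ᵒᵖ Type).obj (diag (Theta (n + 1))).op ⋙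
        realizeSets (simplexSpace.prod (thetaCell (n + 1)) ⋙ kProd)

/-- The geometric realisation `|X|_{Θ_n} = X ⊗_{Θ_n} Θ_n^-` of `Θ_n`-spaces. -/
noncomputable def thetaRealization (n : ℕ) : ((Theta n)ᵒᵖ ⥤ CGTop.{u}) ⥤ CGTop.{u} :=
  tensor (thetaCell n)

/-! ### `Γ`-spaces and the Segal spectrum -/

/-- `Γ`-spaces `A : Γᵒᵖ → Top`; they are reduced: `A(0̲)` is a one-point space. -/
abbrev GammaSpace : Type (u + 1) :=
  ObjectProperty.FullSubcategory
    fun A : Gamᵒᵖ ⥤ CGTop.{u} ↦ Nonempty (Unique (A.obj (op ⟨0⟩)))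

/-- The inverse image `γ_n^*A` of a `Γ`-space along the assembly functor. -/
noncomputable def assemblyPullback (n : ℕ) : GammaSpace.{u} ⥤ ((Theta n)ᵒᵖ ⥤ CGTop.{u}) :=
  ObjectProperty.ι _ ⋙
    (Functor.whiskeringLeft (Theta n)ᵒᵖ Gamᵒᵖ CGTop.{u}).obj (assembly n).op

open Classical in
/-- The map `X^m → X^n` induced by a `Γ`-operator `(M_1, …, M_m) : m̲ → n̲` and a base point `x₀`:
it takes `(x_1, …, x_m)` to `(y_1, …, y_n)` with `y_j = x_i` if `j ∈ M_i`, and `y_j = x₀` if `j`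
lies in none of the `M_i`. -/
noncomputable def powerMap {X : Type u} (x₀ : X) {m n : Gam} (f : m ⟶ n) (x : Fin m.card → X)
    (j : Fin n.card) : X :=
  if h : ∃ i, j ∈ f.sets i then x h.choose else x₀

theorem powerMap_of_mem {X : Type u} (x₀ : X) {m n : Gam} (f : m ⟶ n) (x : Fin m.card → X)
    {i : Fin m.card} {j : Fin n.card} (h : j ∈ f.sets i) : powerMap x₀ f x j = x i := by
  have h' : ∃ i, j ∈ f.sets i := ⟨i, h⟩
  rw [powerMap, dif_pos h', Gam.Hom.eq_of_mem f h'.choose_spec h]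

theorem powerMap_of_notMem {X : Type u} (x₀ : X) {m n : Gam} (f : m ⟶ n) (x : Fin m.card → X)
    {j : Fin n.card} (h : ∀ i, j ∉ f.sets i) : powerMap x₀ f x j = x₀ := by
  rw [powerMap, dif_neg (by simpa using h)]

theorem continuous_powerMap {X : Type u} [TopologicalSpace X] (x₀ : X) {m n : Gam} (f : m ⟶ n) :
    Continuous (powerMap x₀ f) := by
  refine continuous_pi fun j ↦ ?_
  by_cases h : ∃ i, j ∈ f.sets i
  · obtain ⟨i, h⟩ := h
    simpa only [powerMap_of_mem x₀ f _ h] using continuous_apply i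
  · push Not at h
    simpa only [powerMap_of_notMem x₀ f _ h] using continuous_const

/-- The functor `X^- : Γ → Top`, `n̲ ↦ X^n`, associated with a based space `(X, x₀)`. -/
noncomputable def power (X : CGTop.{u}) (x₀ : X) : Gam ⥤ CGTop.{u} where
  obj n := kify.obj (TopCat.of (Fin n.card → X))
  map f := kify.map (TopCat.ofHom ⟨powerMap x₀ f, continuous_powerMap x₀ f⟩)
  map_id n := by
    rw [← kify.map_id]
    congr 1
    ext x j
    exact powerMap_of_mem x₀ (𝟙 n) x (Gam.mem_id.2 rfl)
  map_comp {m n p} f g := by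
    rw [← kify.map_comp]
    congr 1
    ext x l
    change powerMap x₀ (f ≫ g) x l = powerMap x₀ g (powerMap x₀ f x) l
    by_cases h : ∃ j, l ∈ g.sets j
    · obtain ⟨j, hl⟩ := h
      rw [powerMap_of_mem x₀ g _ hl]
      by_cases h' : ∃ i, j ∈ f.sets i
      · obtain ⟨i, hj⟩ := h'
        rw [powerMap_of_mem x₀ f _ hj, powerMap_of_mem x₀ (f ≫ g) _ (Gam.mem_comp.2 ⟨j, hj, hl⟩)]
      · push Not at h'
        rw [powerMap_of_notMem x₀ f _ h']
        refine powerMap_of_notMem x₀ _ _ fun i hi ↦ ?_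
        obtain ⟨j', hj', hl'⟩ := Gam.mem_comp.1 hi
        obtain rfl := Gam.Hom.eq_of_mem g hl hl'
        exact h' i hj'
    · push Not at h
      rw [powerMap_of_notMem x₀ g _ h]
      refine powerMap_of_notMem x₀ _ _ fun i hi ↦ ?_
      obtain ⟨j', hj', hl'⟩ := Gam.mem_comp.1 hi
      exact h j' hl'

/-- The functor `A ↦ A̲(X) = A ⊗_Γ X^-`, for a based space `(X, x₀)`. -/
noncomputable def evalAt (X : CGTop.{u}) (x₀ : X) : GammaSpace.{u} ⥤ CGTop.{u} :=
  ObjectProperty.ι _ ⋙ tensor (power X x₀)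

/-- The `n`-sphere (the unit sphere of `ℝⁿ⁺¹`, a compact Hausdorff space). -/
noncomputable def sphereSpace (n : ℕ) : CGTop.{u} := kify.obj (TopCat.sphere.{u} n)

/-- The base point `(1, 0, …, 0)` of the `n`-sphere. -/
noncomputable def sphereBase (n : ℕ) : sphereSpace.{u} n :=
  (WithGeneratedByTopology.equiv (X := compHausFamily.{u})).symm
    (ULift.up (⟨EuclideanSpace.single (0 : Fin (n + 1)) (1 : ℝ), by simp⟩ :
      Metric.sphere (0 : EuclideanSpace ℝ (Fin (n + 1))) 1))

/-- The `n`-th space `A̲(S^n)` of the Segal spectrum of a `Γ`-space `A`. -/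
noncomputable def segalSpectrumSpace (n : ℕ) : GammaSpace.{u} ⥤ CGTop.{u} :=
  evalAt (sphereSpace n) (sphereBase n)

end ThetaSpaces

namespace ThetaSpaces

/-! ### Products and tensor products of compactly generated spaces -/

/-! Partial sums of barycentric coordinates, read modulo the ends of the unit interval, give natural
maps from the simplex Δ^m to (S^1)^m. Through S^1 ∧ S^n = S^{n+1} they propagate to natural
coordinates of the cell of each T in Θ_n, with values in (S^n)^{γ_n(T)}. These induce the canonical
map from γ_n^*A ⊗ Θ_n^- to A ⊗_Γ (S^n)^-, which is visibly continuous and natural in A.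

For an inverse, write z in (S^n)^p as f_*(coordinates of x) for a Γ-operator f and a cell point x
(`CellCoords.exists_rep`), and send [a, z] to [f^*a, x]. Independence of the choice is the crux
(`CellCoords.tensorMk_eq`). Any two cell points are images of one generic point, whose coordinates
are distinct and off the base point. A Γ-operator is determined by its effect on such a tuple
(`powerMap_left_injective`), so the two operators agree after passing to the generic point.

The inverse is continuous because one compact family of cell points, together with finitely many
operators, already covers (S^n)^p. This surjection from a compact space to a Hausdorff one is a
quotient map, it stays one after taking products in compactly generated spaces, and on the cover the
inverse has an explicit formula (`CellCoords.continuous_ofPower`).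

`CellCoords` isolates what this argument needs. `IsCollapse.simplexCoords` provides it for Δ, and
`CellCoords.wreath` carries it from C to Δ ≀ C, where every cell point comes from a diagonal cell
Δ^m × G(c). -/

instance (K L : CompHaus.{u}) :
    IsGeneratedBy compHausFamily.{u} (compHausFamily.{u} K × compHausFamily.{u} L) :=
  inferInstanceAs (IsGeneratedBy compHausFamily.{u}
    (compHausFamily.{u} (CompHaus.of (K.toTop × L.toTop))))

instance isGeneratedBy_of_compactSpace (K : Type u) [TopologicalSpace K] [CompactSpace K]
    [T2Space K] : IsGeneratedBy compHausFamily.{u} K :=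
  inferInstanceAs (IsGeneratedBy compHausFamily.{u} (compHausFamily.{u} (CompHaus.of K)))

instance (K : CompHaus.{u}) : LocallyCompactSpace (compHausFamily.{u} K) :=
  have h (T : Type u) [TopologicalSpace T] [CompactSpace T] [T2Space T] :
    LocallyCompactSpace T := inferInstance
  h K.toTop

/-- In compactly generated spaces, the product of a space with a quotient map is again a quotient
map. -/
theorem continuousGeneratedBy_of_isQuotientMap {Y Q P Z : Type u} [TopologicalSpace Y]
    [TopologicalSpace Q] [TopologicalSpace P] [TopologicalSpace Z]
    [IsGeneratedBy compHausFamily.{u} Q] {q : Q → P} (hq : IsQuotientMap q) (g : Y × P → Z)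
    (hg : ContinuousGeneratedBy compHausFamily.{u} fun x : Y × Q ↦ g (x.1, q x.2)) :
    ContinuousGeneratedBy compHausFamily.{u} g := by
  have hp (p : P) : ContinuousGeneratedBy compHausFamily.{u} fun y ↦ g (y, p) := by
    obtain ⟨t, rfl⟩ := hq.surjective p
    exact hg.comp (Continuous.prodMk_left t).continuousGeneratedBy
  -- Cartesian closedness: once the Y variable is curried away, continuity in P can be tested after
  -- composing with the quotient map from Q.
  let g' : P → ContinuousMapGeneratedBy compHausFamily.{u} Y Z := fun p ↦ ⟨_, hp p⟩
  have hg' : Continuous g' := by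
    rw [hq.continuous_iff, IsGeneratedBy.continuous_iff compHausFamily.{u}]
    exact (ContinuousMapGeneratedBy.curryEquiv
      (⟨_, hg⟩ : ContinuousMapGeneratedBy compHausFamily.{u} (Y × Q) Z)).prop
  exact (ContinuousMapGeneratedBy.curryEquiv.symm ⟨g', hg'.continuousGeneratedBy⟩).prop

section TensorAPI

variable {C : Type} [SmallCategory C] {F : Cᵒᵖ ⥤ CGTop.{u}} {G : C ⥤ CGTop.{u}}

/-- The class of `(x, y) ∈ F(c) × G(c)` in `F ⊗_C G`. -/
noncomputable def tensorMk (c : C) (x : F.obj (op c)) (y : G.obj c) : tensorObj F G :=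
  Quot.mk _ ⟨c, (WithGeneratedByTopology.equiv (X := compHausFamily.{u})).symm (x, y)⟩

theorem tensorMk_glue {c d : C} (f : c ⟶ d) (x : F.obj (op d)) (y : G.obj c) :
    tensorMk (F := F) c ((F.map f.op).hom x) y = tensorMk d x ((G.map f).hom y) :=
  Quot.sound (TensorRel.glue f x y)

theorem tensorMk_surjective (z : tensorObj F G) : ∃ c x y, tensorMk (F := F) (G := G) c x y = z := by
  obtain ⟨⟨c, p⟩, rfl⟩ := Quot.exists_rep (r := TensorRel F G) z
  exact ⟨c, p.1, p.2, rfl⟩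

/-- The map out of `F ⊗_C G` induced by a family of maps which are compatible with the
identifications. -/
noncomputable def tensorLift {Z : Type u} (g : ∀ c, F.obj (op c) → G.obj c → Z)
    (hg : ∀ {c d : C} (f : c ⟶ d) (x : F.obj (op d)) (y : G.obj c),
      g c ((F.map f.op).hom x) y = g d x ((G.map f).hom y)) : tensorObj F G → Z :=
  Quot.lift (fun p ↦ g p.1 (WithGeneratedByTopology.equiv (X := compHausFamily.{u}) p.2).1
    (WithGeneratedByTopology.equiv (X := compHausFamily.{u}) p.2).2) (by
      rintro _ _ ⟨f, x, y⟩
      exact hg f x y)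

/-- The tensor product is a quotient of a disjoint union, and its summands carry the compactly
generated refinement of the product topology. Hence the condition on the ordinary product is
continuity along test spaces only. -/
theorem continuous_tensor_iff {Z : Type u} [TopologicalSpace Z] {g : tensorObj F G → Z} :
    Continuous g ↔ ∀ c, ContinuousGeneratedBy compHausFamily.{u}
      fun p : F.obj (op c) × G.obj c ↦ g (tensorMk c p.1 p.2) := by
  refine (isQuotientMap_quot_mk (r := TensorRel F G)).continuous_iff.trans ?_
  refine continuous_sigma_iff.trans (forall_congr' fun c ↦ ?_)
  exact WithGeneratedByTopology.continuous_from_iff (Y := F.obj (op c) × G.obj c) _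

theorem continuousGeneratedBy_tensorMk (c : C) : ContinuousGeneratedBy compHausFamily.{u}
    fun p : F.obj (op c) × G.obj c ↦ tensorMk (F := F) (G := G) c p.1 p.2 :=
  continuous_tensor_iff.1 continuous_id c

theorem continuous_tensorMk {Z : Type*} [TopologicalSpace Z] [IsGeneratedBy compHausFamily.{u} Z]
    (c : C) {a : Z → F.obj (op c)} {b : Z → G.obj c} (ha : Continuous a) (hb : Continuous b) :
    Continuous fun z ↦ tensorMk (F := F) (G := G) c (a z) (b z) := by
  rw [IsGeneratedBy.continuous_iff compHausFamily.{u}]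
  exact (continuousGeneratedBy_tensorMk c).comp (ha.prodMk hb).continuousGeneratedBy

end TensorAPI

/-- A map from a compactly generated space to a space is continuous if and only if it is
continuous with respect to the associated compactly generated topology. -/
theorem continuous_kify_iff {Z : Type*} [TopologicalSpace Z] [IsGeneratedBy compHausFamily.{u} Z]
    {Y : TopCat.{u}} {g : Z → kify.obj Y} :
    Continuous g ↔ Continuous fun z ↦
      (WithGeneratedByTopology.equiv (X := compHausFamily.{u}) (Y := Y) (g z) : Y) :=
  IsGeneratedBy.equiv_symm_comp_continuous_iff (X := compHausFamily.{u})
    (fun z ↦ (WithGeneratedByTopology.equiv (X := compHausFamily.{u}) (Y := Y) (g z) : Y))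

/-! ### Γ-operators acting on tuples -/

theorem powerMap_id {X : Type u} (x₀ : X) (m : Gam) (x : Fin m.card → X) :
    powerMap x₀ (𝟙 m) x = x :=
  funext fun _ ↦ powerMap_of_mem x₀ (𝟙 m) x (Gam.mem_id.2 rfl)

theorem powerMap_comp {X : Type u} (x₀ : X) {m n p : Gam} (f : m ⟶ n) (g : n ⟶ p)
    (x : Fin m.card → X) : powerMap x₀ (f ≫ g) x = powerMap x₀ g (powerMap x₀ f x) := by
  funext l
  by_cases h : ∃ j, l ∈ g.sets j
  · obtain ⟨j, hl⟩ := h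
    rw [powerMap_of_mem x₀ g _ hl]
    by_cases h' : ∃ i, j ∈ f.sets i
    · obtain ⟨i, hj⟩ := h'
      rw [powerMap_of_mem x₀ f _ hj, powerMap_of_mem x₀ (f ≫ g) _ (Gam.mem_comp.2 ⟨j, hj, hl⟩)]
    · push Not at h'
      rw [powerMap_of_notMem x₀ f _ h']
      refine powerMap_of_notMem x₀ _ _ fun i hi ↦ ?_
      obtain ⟨j', hj', hl'⟩ := Gam.mem_comp.1 hi
      obtain rfl := Gam.Hom.eq_of_mem g hl hl'
      exact h' i hj'
  · push Not at h
    rw [powerMap_of_notMem x₀ g _ h]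
    refine powerMap_of_notMem x₀ _ _ fun i hi ↦ ?_
    obtain ⟨j', hj', hl'⟩ := Gam.mem_comp.1 hi
    exact h j' hl'

/-- If the coordinates of `x` are distinct and different from the base point, then a `Γ`-operator
`f` is determined by the image of `x`. -/
theorem powerMap_left_injective {X : Type u} {x₀ : X} {m n : Gam} {x : Fin m.card → X}
    (hx : Function.Injective x) (hx₀ : ∀ i, x i ≠ x₀) {f g : m ⟶ n}
    (h : powerMap x₀ f x = powerMap x₀ g x) : f = g := by
  have key : ∀ {f g : m ⟶ n}, powerMap x₀ f x = powerMap x₀ g x →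
      ∀ i j, j ∈ f.sets i → j ∈ g.sets i := by
    intro f g h i j hj
    have e := congrFun h j
    rw [powerMap_of_mem x₀ f x hj] at e
    by_cases h' : ∃ i', j ∈ g.sets i'
    · obtain ⟨i', hi'⟩ := h'
      rw [powerMap_of_mem x₀ g x hi'] at e
      rwa [hx e]
    · push Not at h'
      rw [powerMap_of_notMem x₀ g x h'] at e
      exact absurd e (hx₀ i)
  exact Gam.hom_ext fun i ↦ Set.ext fun j ↦ ⟨key h i j, key h.symm i j⟩

/-- Finiteness keeps the space of pairs (operator, point of a compact family) compact in
`CellCoords.continuous_ofPower`. -/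
instance (m n : Gam) : Finite (m ⟶ n) :=
  Finite.of_injective (fun f : m ⟶ n ↦ f.sets) fun _ _ h ↦ Gam.Hom.ext h

/-! ### Coordinates on cells -/

/-- A family of natural coordinates `G(c) → M^{γ(c)}`, for functors `γ : C → Γ` and
`G : C → Top`, which exhibits `M^-` as the left Kan extension of `G` along `γ`. -/
structure CellCoords {C : Type} [SmallCategory C] (γ : C ⥤ Gam) (G : C ⥤ CGTop.{u}) (M : Type u)
    [TopologicalSpace M] (m₀ : M) where
  /-- The coordinates. -/
  coord : ∀ c, G.obj c → Fin (γ.obj c).card → M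
  continuous_coord : ∀ c, Continuous (coord c)
  naturality : ∀ {c d : C} (f : c ⟶ d) (x : G.obj c),
    coord d ((G.map f).hom x) = powerMap m₀ (γ.map f) (coord c x)
  /-- Two points have a common refinement by a generic point. -/
  exists_refinement : ∀ (c c' : C) (x : G.obj c) (x' : G.obj c'), ∃ (d : C) (s : G.obj d)
    (f : d ⟶ c) (f' : d ⟶ c'), (G.map f).hom s = x ∧ (G.map f').hom s = x' ∧
      Function.Injective (coord d s) ∧ ∀ i, coord d s i ≠ m₀
  /-- The sets of at most `k` points of `M` are covered by the coordinates of a compact family. -/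
  exists_cover : ∀ k : ℕ, ∃ (c : C) (K : CompHaus.{u}) (κ : K.toTop → G.obj c), Continuous κ ∧
    ∀ W : Finset M, W.card ≤ k → m₀ ∉ W → ∃ y, ∀ w ∈ W, ∃ i, coord c (κ y) i = w

namespace CellCoords

variable {C : Type} [SmallCategory C] {γ : C ⥤ Gam} {G : C ⥤ CGTop.{u}} {M : CGTop.{u}} {m₀ : M}

theorem exists_powerMap_eq {m p : Gam} (x : Fin m.card → M) (z : Fin p.card → M)
    (h : ∀ j, z j ≠ m₀ → ∃ i, x i = z j) : ∃ f : m ⟶ p, powerMap m₀ f x = z := by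
  choose i hi using h
  -- Each index j with z j ≠ m₀ is assigned to one chosen i, so the sets are disjoint even if x has
  -- repeated entries. The indices with z j = m₀ lie in no set.
  refine ⟨⟨fun k ↦ {j | ∃ hj : z j ≠ m₀, i j hj = k}, fun k k' hk ↦ ?_⟩, ?_⟩
  · refine Set.disjoint_left.2 ?_
    rintro j ⟨hj, rfl⟩ ⟨hj', rfl⟩
    exact hk rfl
  · funext j
    by_cases hj : z j = m₀
    · rw [powerMap_of_notMem, hj]
      rintro k ⟨hj', -⟩
      exact hj' hj
    · refine (powerMap_of_mem m₀ _ x (i := i j hj) ?_).trans (hi j hj)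
      exact ⟨hj, rfl⟩

/-- The non-base values of a p-tuple form a set of at most p points. If all of them occur among the
coordinates of a cell point, some operator distributes them to the right places. -/
theorem exists_cover_power (D : CellCoords γ G M m₀) (p : Gam) :
    ∃ (c : C) (K : CompHaus.{u}) (κ : K.toTop → G.obj c), Continuous κ ∧
      ∀ z : Fin p.card → M, ∃ (f : γ.obj c ⟶ p) (y : K.toTop),
        powerMap m₀ f (D.coord c (κ y)) = z := by
  classical
  obtain ⟨c, K, κ, hκ, h⟩ := D.exists_cover p.card
  refine ⟨c, K, κ, hκ, fun z ↦ ?_⟩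
  obtain ⟨y, hy⟩ := h ((Finset.univ.image z).erase m₀)
    ((Finset.card_erase_le.trans Finset.card_image_le).trans (by simp)) (by simp)
  obtain ⟨f, hf⟩ := exists_powerMap_eq (m₀ := m₀) (D.coord c (κ y)) z fun j hj ↦ hy _ (by simp [hj])
  exact ⟨f, y, hf⟩

theorem exists_rep (D : CellCoords γ G M m₀) {p : Gam} (z : Fin p.card → M) :
    ∃ (c : C) (f : γ.obj c ⟶ p) (x : G.obj c), powerMap m₀ f (D.coord c x) = z := by
  obtain ⟨c, K, κ, -, h⟩ := D.exists_cover_power p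
  obtain ⟨f, y, h⟩ := h z
  exact ⟨c, f, κ y, h⟩

/-! ### The comparison map and its inverse -/

variable (D : CellCoords γ G M m₀) (A : Gamᵒᵖ ⥤ CGTop.{u})

/-- This makes the inverse well defined: both classes can be moved to a common generic point, where
the operators f and f' become equal. -/
theorem tensorMk_eq {p : Gam} (a : A.obj (op p)) {c c' : C} {f : γ.obj c ⟶ p} {f' : γ.obj c' ⟶ p}
    {x : G.obj c} {x' : G.obj c'}
    (h : powerMap m₀ f (D.coord c x) = powerMap m₀ f' (D.coord c' x')) :
    tensorMk (F := γ.op ⋙ A) (G := G) c ((A.map f.op).hom a) x =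
      tensorMk c' ((A.map f'.op).hom a) x' := by
  obtain ⟨d, s, g, g', rfl, rfl, hs, hs₀⟩ := D.exists_refinement c c' x x'
  rw [D.naturality, D.naturality, ← powerMap_comp, ← powerMap_comp] at h
  -- Genericity of s turns equality of the two image tuples into equality of the composite
  -- operators.
  have e := powerMap_left_injective hs hs₀ h
  rw [← tensorMk_glue (F := γ.op ⋙ A), ← tensorMk_glue (F := γ.op ⋙ A)]
  congr 1
  change (A.map f.op ≫ A.map (γ.map g).op).hom a = (A.map f'.op ≫ A.map (γ.map g').op).hom a
  rw [← A.map_comp, ← A.map_comp, ← op_comp, ← op_comp, e]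

/-- The canonical map `γ^*A ⊗_C G → A ⊗_Γ M^-`. -/
noncomputable def toPower : tensorObj (γ.op ⋙ A) G → tensorObj A (power M m₀) :=
  tensorLift (fun c x y ↦ tensorMk (F := A) (G := power M m₀) (γ.obj c) x
    ((WithGeneratedByTopology.equiv (X := compHausFamily.{u})).symm (D.coord c y))) (by
      intro c d f x y
      rw [D.naturality]
      exact tensorMk_glue (F := A) (G := power M m₀) (γ.map f) x
        ((WithGeneratedByTopology.equiv (X := compHausFamily.{u})).symm (D.coord c y)))

theorem continuous_toPower : Continuous (D.toPower A) := by
  rw [continuous_tensor_iff]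
  intro c
  let g : G.obj c → (power M m₀).obj (γ.obj c) := fun y ↦
    (WithGeneratedByTopology.equiv (X := compHausFamily.{u})).symm (D.coord c y)
  have hg : Continuous g := continuous_kify_iff.2 (D.continuous_coord c)
  have h : Continuous fun p : A.obj (op (γ.obj c)) × G.obj c ↦ (p.1, g p.2) :=
    continuous_fst.prodMk (hg.comp continuous_snd)
  exact (continuousGeneratedBy_tensorMk (F := A) (G := power M m₀) (γ.obj c)).comp
    h.continuousGeneratedBy

/-- The inverse of the canonical map `γ^*A ⊗_C G → A ⊗_Γ M^-`. -/
noncomputable def ofPower : tensorObj A (power M m₀) → tensorObj (γ.op ⋙ A) G :=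
  tensorLift (fun p a z ↦
    tensorMk (F := γ.op ⋙ A) (G := G)
      (D.exists_rep (WithGeneratedByTopology.equiv (X := compHausFamily.{u})
        (Y := Fin p.card → M) z)).choose
      ((A.map (D.exists_rep (WithGeneratedByTopology.equiv
        (X := compHausFamily.{u}) (Y := Fin p.card → M) z)).choose_spec.choose.op).hom a)
      (D.exists_rep (WithGeneratedByTopology.equiv
        (X := compHausFamily.{u}) (Y := Fin p.card → M) z)).choose_spec.choose_spec.choose) (by
    intro p q g a z
    set z' := (WithGeneratedByTopology.equiv (X := compHausFamily.{u}) (Y := Fin p.card → M) z)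
    have h := (D.exists_rep z').choose_spec.choose_spec.choose_spec
    have h' := (D.exists_rep (powerMap m₀ g z')).choose_spec.choose_spec.choose_spec
    refine Eq.trans ?_ (D.tensorMk_eq A a (f := (D.exists_rep z').choose_spec.choose ≫ g)
      (x := (D.exists_rep z').choose_spec.choose_spec.choose)
      (f' := (D.exists_rep (powerMap m₀ g z')).choose_spec.choose)
      (x' := (D.exists_rep (powerMap m₀ g z')).choose_spec.choose_spec.choose) ?_)
    · rw [op_comp, A.map_comp]
      rfl
    · rw [powerMap_comp, h, h'])

/-- The arbitrary choice inside the inverse is harmless: any presentation of z computes it. Both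
inverse laws and continuity rest on this. -/
theorem ofPower_tensorMk {p : Gam} (a : A.obj (op p)) {c : C} (f : γ.obj c ⟶ p) (x : G.obj c)
    (z : (power M m₀).obj p)
    (h : powerMap m₀ f (D.coord c x) =
      WithGeneratedByTopology.equiv (X := compHausFamily.{u}) (Y := Fin p.card → M) z) :
    D.ofPower A (tensorMk p a z) = tensorMk (F := γ.op ⋙ A) c ((A.map f.op).hom a) x := by
  refine D.tensorMk_eq A a ?_
  rw [h]
  exact (D.exists_rep _).choose_spec.choose_spec.choose_spec

theorem ofPower_toPower (x : tensorObj (γ.op ⋙ A) G) : D.ofPower A (D.toPower A x) = x := by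
  obtain ⟨c, a, y, rfl⟩ := tensorMk_surjective x
  refine (D.ofPower_tensorMk A a (𝟙 _) y _ (powerMap_id _ _ _)).trans ?_
  congr 1
  rw [op_id, A.map_id]
  rfl

theorem toPower_ofPower (x : tensorObj A (power M m₀)) : D.toPower A (D.ofPower A x) = x := by
  obtain ⟨p, a, z, rfl⟩ := tensorMk_surjective x
  obtain ⟨c, f, y, h⟩ := D.exists_rep
    (WithGeneratedByTopology.equiv (X := compHausFamily.{u}) (Y := Fin p.card → M) z)
  rw [D.ofPower_tensorMk A a f y z h]
  refine (tensorMk_glue (F := A) (G := power M m₀) f a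
    ((WithGeneratedByTopology.equiv (X := compHausFamily.{u})).symm (D.coord c y))).trans ?_
  congr 1

theorem continuous_ofPower [CompactSpace M] [T2Space M] : Continuous (D.ofPower A) := by
  rw [continuous_tensor_iff]
  intro p
  obtain ⟨c, K, κ, hκ, h⟩ := D.exists_cover_power p
  -- With the finite set of operators made discrete, operators × K is a compact space mapping onto
  -- M^p.
  let _ : TopologicalSpace (γ.obj c ⟶ p) := ⊥
  have : DiscreteTopology (γ.obj c ⟶ p) := ⟨rfl⟩
  let q : (γ.obj c ⟶ p) × K.toTop → (power M m₀).obj p := fun y ↦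
    (WithGeneratedByTopology.equiv (X := compHausFamily.{u})).symm
      (powerMap m₀ y.1 (D.coord c (κ y.2)))
  have hq : Continuous q := by
    refine continuous_kify_iff.2 ?_
    rw [continuous_prod_of_discrete_left]
    exact fun f ↦ (continuous_powerMap m₀ f).comp ((D.continuous_coord c).comp hκ)
  have hs : Function.Surjective q := fun z ↦ by
    obtain ⟨f, y, hz⟩ := h z
    exact ⟨(f, y), hz⟩
  have : T2Space ((power M m₀).obj p) := by
    refine T2Space.of_injective_continuous (Y := Fin p.card → M)
      (WithGeneratedByTopology.equiv (X := compHausFamily.{u})).injective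
      WithGeneratedByTopology.continuous_equiv
  refine continuousGeneratedBy_of_isQuotientMap (hq.isClosedMap.isQuotientMap hq hs) _ ?_
  -- On the cover the chosen presentation may be replaced by the tautological one, which depends
  -- continuously on the point.
  have e : (fun x : A.obj (op p) × ((γ.obj c ⟶ p) × K.toTop) ↦
      D.ofPower A (tensorMk p x.1 (q x.2))) = fun x ↦
      tensorMk (F := γ.op ⋙ A) (G := G) c ((A.map x.2.1.op).hom x.1) (κ x.2.2) :=
    funext fun x ↦ D.ofPower_tensorMk A x.1 x.2.1 (κ x.2.2) _ rfl
  -- Along a test space L, the operator varies in a discrete space, so it can be held fixed.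
  refine e ▸ fun L φ ↦ ?_
  have h2 : Continuous fun y : (γ.obj c ⟶ p) × compHausFamily.{u} L ↦
      tensorMk (F := γ.op ⋙ A) (G := G) c ((A.map y.1.op).hom (φ y.2).1) (κ (φ y.2).2.2) := by
    rw [continuous_prod_of_discrete_left]
    intro f
    refine continuous_tensorMk (F := γ.op ⋙ A) (G := G) c
      ((A.map f.op).hom.hom.continuous.comp φ.continuous.fst)
      (hκ.comp φ.continuous.snd.snd)
  exact h2.comp (φ.continuous.snd.fst.prodMk continuous_id)

/-- The canonical homeomorphism `γ^*A ⊗_C G ≅ A ⊗_Γ M^-`. -/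
noncomputable def tensorHomeomorph [CompactSpace M] [T2Space M] :
    tensorObj (γ.op ⋙ A) G ≃ₜ tensorObj A (power M m₀) where
  toFun := D.toPower A
  invFun := D.ofPower A
  left_inv := D.ofPower_toPower A
  right_inv := D.toPower_ofPower A
  continuous_toFun := D.continuous_toPower A
  continuous_invFun := D.continuous_ofPower A

theorem toPower_naturality {A B : Gamᵒᵖ ⥤ CGTop.{u}} (f : A ⟶ B)
    (x : tensorObj (γ.op ⋙ A) G) :
    D.toPower B ((tensorMap (Functor.whiskerLeft γ.op f) G).hom x) =
      (tensorMap f (power M m₀)).hom (D.toPower A x) := by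
  obtain ⟨c, a, y, rfl⟩ := tensorMk_surjective x
  rfl

end CellCoords

/-! ### Simplices -/

section PartialSums

/-- The partial sums of the barycentric coordinates of a point of a simplex. -/
noncomputable def partialSum {m : ℕ} (t : stdSimplex ℝ (Fin (m + 1))) (j : ℕ) : ℝ :=
  ∑ i with i.val < j, t i

variable {m : ℕ} (t : stdSimplex ℝ (Fin (m + 1)))

theorem partialSum_zero : partialSum t 0 = 0 := by simp [partialSum]

theorem partialSum_last : partialSum t (m + 1) = 1 := by
  rw [← stdSimplex.sum_eq_one t, partialSum]
  congr 1
  ext i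
  simpa using Nat.lt_succ_iff.1 i.2

theorem partialSum_succ {j : ℕ} (hj : j < m + 1) :
    partialSum t (j + 1) = partialSum t j + t ⟨j, hj⟩ := by
  have : (Finset.univ.filter fun i : Fin (m + 1) ↦ i.val < j + 1) =
      insert ⟨j, hj⟩ (Finset.univ.filter fun i : Fin (m + 1) ↦ i.val < j) := by
    ext i
    simp [Fin.ext_iff]
    omega
  rw [partialSum, this, Finset.sum_insert (by simp), add_comm, partialSum]

theorem partialSum_mono : Monotone (partialSum t) := fun _ _ h ↦
  Finset.sum_le_sum_of_subset_of_nonneg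
    (fun i hi ↦ by simp only [Finset.mem_filter, Finset.mem_univ, true_and] at hi ⊢; omega)
    fun i _ _ ↦ stdSimplex.zero_le t i

theorem partialSum_mem_Icc (j : ℕ) : partialSum t j ∈ Set.Icc (0 : ℝ) 1 :=
  ⟨Finset.sum_nonneg fun i _ ↦ stdSimplex.zero_le t i, by
    rw [← stdSimplex.sum_eq_one t]
    exact Finset.sum_le_sum_of_subset_of_nonneg (Finset.filter_subset _ _)
      fun i _ _ ↦ stdSimplex.zero_le t i⟩

/-- Barycentric coordinates are differences of successive partial sums; the two extreme sums are
always 0 and 1, so only the m inner ones matter. -/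
theorem stdSimplex_ext_partialSum {t t' : stdSimplex ℝ (Fin (m + 1))}
    (h : ∀ j, j < m → partialSum t (j + 1) = partialSum t' (j + 1)) : t = t' := by
  have h' : ∀ j, j ≤ m + 1 → partialSum t j = partialSum t' j := by
    rintro (_ | j) hj
    · rw [partialSum_zero, partialSum_zero]
    · obtain hj | rfl : j < m ∨ j = m := by omega
      · exact h j hj
      · rw [partialSum_last, partialSum_last]
  refine stdSimplex.ext (funext fun i ↦ ?_)
  have h1 := partialSum_succ t i.2
  have h2 := partialSum_succ t' i.2
  rw [h' _ (by omega), h' _ (by omega), h2] at h1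
  exact (add_left_cancel h1).symm

theorem partialSum_map {k : ℕ} (f : Fin (m + 1) → Fin (k + 1)) (j : ℕ) :
    partialSum (stdSimplex.map f t) j = ∑ i with (f i).val < j, t i := by
  have h (y : Fin (k + 1)) : stdSimplex.map f t y = ∑ i with f i = y, t i := by
    simp only [stdSimplex.map_coe, FunOnFinite.linearMap_apply_apply]
  simp only [partialSum, h]
  rw [Finset.sum_filter]
  rw [← Finset.sum_fiberwise (Finset.univ.filter fun i ↦ (f i).val < j) f]
  refine Finset.sum_congr rfl fun y _ ↦ ?_
  rw [Finset.filter_filter]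
  split_ifs with hy
  · refine Finset.sum_congr ?_ fun _ _ ↦ rfl
    ext i
    simp only [Finset.mem_filter, Finset.mem_univ, true_and]
    exact ⟨fun h ↦ ⟨h ▸ hy, h⟩, fun h ↦ h.2⟩
  · refine (Finset.sum_eq_zero fun i hi ↦ ?_).symm
    simp only [Finset.mem_filter, Finset.mem_univ, true_and] at hi
    exact absurd (hi.2 ▸ hi.1) hy

theorem continuous_partialSum (j : ℕ) :
    Continuous fun t : stdSimplex ℝ (Fin (m + 1)) ↦ partialSum t j :=
  continuous_finsetSum _ fun i _ ↦ (continuous_apply i).comp continuous_subtype_val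

/-- The point of a simplex with given partial sums. -/
noncomputable def simplexOfPartialSums {N : ℕ} (v : Fin (N + 2) → ℝ) (hv : Monotone v)
    (h₀ : v 0 = 0) (h₁ : v (Fin.last _) = 1) : stdSimplex ℝ (Fin (N + 1)) :=
  ⟨fun i ↦ v i.succ - v i.castSucc, fun i ↦ sub_nonneg.2 (hv i.castSucc_le_succ), by
    have : ∀ (n : ℕ) (w : Fin (n + 1) → ℝ),
        ∑ i : Fin n, (w i.succ - w i.castSucc) = w (Fin.last _) - w 0 := by
      intro n w
      induction n with
      | zero => simp
      | succ n ih =>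
        rw [Fin.sum_univ_castSucc]
        have := ih fun i ↦ w i.castSucc
        simp only [Fin.succ_castSucc, Fin.castSucc_zero] at this ⊢
        rw [this, Fin.succ_last]
        ring
    rw [this, h₀, h₁, sub_zero]⟩

theorem partialSum_simplexOfPartialSums {N : ℕ} {v : Fin (N + 2) → ℝ} (hv : Monotone v)
    (h₀ : v 0 = 0) (h₁ : v (Fin.last _) = 1) (j : ℕ) (hj : j < N + 2) :
    partialSum (simplexOfPartialSums v hv h₀ h₁) j = v ⟨j, hj⟩ := by
  induction j with
  | zero => rw [partialSum_zero]; exact h₀.symm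
  | succ j ih =>
    rw [partialSum_succ _ (by omega : j < N + 1), ih (by omega)]
    change _ + (v _ - v _) = _
    simp

/-- If all partial sums of `t` occur among those of `s`, then `s` refines `t`. -/
theorem exists_map_simplexOfPartialSums {N : ℕ} {v : Fin (N + 2) → ℝ} (hv : StrictMono v)
    (h₀ : v 0 = 0) (h₁ : v (Fin.last _) = 1) (h : ∀ j < m, partialSum t (j + 1) ∈ Set.range v) :
    ∃ φ : Fin (N + 1) →o Fin (m + 1),
      stdSimplex.map φ (simplexOfPartialSums v hv.monotone h₀ h₁) = t := by
  -- The i-th vertex of the finer simplex goes to the first l whose closing partial sum exceeds `v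
  -- i.castSucc`, that is, to the piece of t containing the i-th small interval.
  have hex (i : Fin (N + 1)) : ∃ l, v i.castSucc < partialSum t (l + 1) :=
    ⟨m, by rw [partialSum_last, ← h₁]; exact hv (Fin.castSucc_lt_last i)⟩
  classical
  have hle (i : Fin (N + 1)) (j : ℕ) :
      Nat.find (hex i) < j + 1 ↔ v i.castSucc < partialSum t (j + 1) := by
    rw [Nat.find_lt_iff]
    exact ⟨fun ⟨l, hl, hl'⟩ ↦ hl'.trans_le (partialSum_mono t (by omega)),
      fun h ↦ ⟨j, by omega, h⟩⟩
  refine ⟨⟨fun i ↦ ⟨Nat.find (hex i), (hle i m).2 ?_⟩, fun i i' hi ↦ ?_⟩, ?_⟩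
  · rw [partialSum_last, ← h₁]
    exact hv (Fin.castSucc_lt_last i)
  · refine Nat.find_mono fun l hl ↦ lt_of_le_of_lt (hv.monotone ?_) hl
    exact Fin.castSucc_le_castSucc_iff.2 hi
  · refine stdSimplex_ext_partialSum fun j hj ↦ ?_
    rw [partialSum_map]
    obtain ⟨l, hl⟩ := h j hj
    rw [← hl]
    -- The vertices sent below j + 1 are exactly those with index below l, so their total weight is
    -- `v l`, the required partial sum of t.
    refine Eq.trans ?_ (partialSum_simplexOfPartialSums hv.monotone h₀ h₁ l.val l.2)
    refine Finset.sum_congr ?_ fun _ _ ↦ rfl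
    ext i
    simp only [Finset.mem_filter, Finset.mem_univ, true_and]
    refine (hle i j).trans ?_
    rw [← hl, hv.lt_iff_lt, Fin.lt_def, Fin.val_castSucc]

theorem exists_strictMono_range (V : Finset ℝ) (hV : ∀ x ∈ V, x ∈ Set.Ioo (0 : ℝ) 1) :
    ∃ v : Fin (V.card + 2) → ℝ, StrictMono v ∧ v 0 = 0 ∧ v (Fin.last _) = 1 ∧
      ∀ x ∈ V, x ∈ Set.range v := by
  have h0 : (0 : ℝ) ∉ V := fun h ↦ lt_irrefl _ (hV 0 h).1
  have h1 : (1 : ℝ) ∉ V := fun h ↦ lt_irrefl _ (hV 1 h).2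
  set s := insert (0 : ℝ) (insert 1 V)
  have hs : s.card = V.card + 2 := by
    rw [Finset.card_insert_of_notMem (by simp [h0]), Finset.card_insert_of_notMem h1]
  have hs' : ∀ x ∈ s, 0 ≤ x ∧ x ≤ 1 := by
    intro x hx
    simp only [s, Finset.mem_insert] at hx
    rcases hx with rfl | rfl | hx
    · simp
    · simp
    · exact ⟨(hV x hx).1.le, (hV x hx).2.le⟩
  have hr : Set.range (s.orderEmbOfFin hs) = s := Finset.range_orderEmbOfFin s hs
  refine ⟨s.orderEmbOfFin hs, (s.orderEmbOfFin hs).strictMono, ?_, ?_, fun x hx ↦ ?_⟩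
  · obtain ⟨i, hi⟩ : (0 : ℝ) ∈ Set.range (s.orderEmbOfFin hs) := by rw [hr]; simp [s]
    refine le_antisymm ?_ (hs' _ (Finset.orderEmbOfFin_mem s hs _)).1
    rw [← hi]
    exact (s.orderEmbOfFin hs).monotone (Fin.zero_le _)
  · obtain ⟨i, hi⟩ : (1 : ℝ) ∈ Set.range (s.orderEmbOfFin hs) := by rw [hr]; simp [s]
    refine le_antisymm (hs' _ (Finset.orderEmbOfFin_mem s hs _)).2 ?_
    rw [← hi]
    exact (s.orderEmbOfFin hs).monotone (Fin.le_last _)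
  · rw [hr]
    simp [s, hx]

end PartialSums

/-- A continuous map which collapses the complement of `U` to the point `s₀`, and is otherwise
a bijection onto the complement of `s₀`. -/
structure IsCollapse {X S : Type*} [TopologicalSpace X] [TopologicalSpace S] (U : Set X) (s₀ : S)
    (f : X → S) : Prop where
  continuous : Continuous f
  eq_iff : ∀ x, f x = s₀ ↔ x ∉ U
  injOn : Set.InjOn f U
  exists_eq : ∀ s, s ≠ s₀ → ∃ x, f x = s

/-! ### Simplices with coordinates in the circle -/

namespace IsCollapse

variable {M : Type u} [TopologicalSpace M] {m₀ : M} {e : unitInterval → M}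

/-- The coordinates of the points of a simplex in the circle, regarded as the quotient of the unit
interval by its boundary. -/
noncomputable def simplexCoord (e : unitInterval → M) (X : SimplexCategory)
    (t : stdSimplex ℝ (Fin (X.len + 1))) (j : Fin (segal.obj X).card) : M :=
  e ⟨partialSum t (j + 1), partialSum_mem_Icc t _⟩

variable (he : IsCollapse {x : unitInterval | 0 < x ∧ x < 1} m₀ e)

-- Partial sums are cut points of the interval. When φ jumps across j in its i-th step, the cut
-- point j of the pushforward is the cut point i of t. When no step jumps across j, that cut point
-- is an end of the interval and is collapsed to the base point.
include he in
theorem simplexCoord_map {X Y : SimplexCategory} (φ : X ⟶ Y)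
    (t : stdSimplex ℝ (Fin (X.len + 1))) :
    simplexCoord e Y (stdSimplex.map φ.toOrderHom t) =
      powerMap m₀ (segal.map φ) (simplexCoord e X t) := by
  funext j
  by_cases h : ∃ i, j ∈ (segal.map φ).sets i
  · obtain ⟨i, hi⟩ := h
    rw [powerMap_of_mem m₀ _ _ hi]
    unfold simplexCoord
    congr 2
    rw [partialSum_map]
    refine Finset.sum_congr ?_ fun _ _ ↦ rfl
    ext l
    simp only [Finset.mem_filter, Finset.mem_univ, true_and]
    change φ.toOrderHom i.castSucc < Fin.succ j ∧ Fin.succ j ≤ φ.toOrderHom i.succ at hi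
    constructor
    · intro h
      by_contra h'
      have : φ.toOrderHom i.succ ≤ φ.toOrderHom l :=
        φ.toOrderHom.monotone (Fin.le_def.2 (by rw [Fin.val_succ]; exact not_lt.1 h'))
      exact absurd (Fin.le_def.1 (hi.2.trans this)) (not_le.2 h)
    · intro h
      have : φ.toOrderHom l ≤ φ.toOrderHom i.castSucc :=
        φ.toOrderHom.monotone (Fin.le_def.2 (by rw [Fin.val_castSucc]; exact Nat.lt_succ_iff.1 h))
      exact Fin.lt_def.1 (this.trans_lt hi.1)
  · push Not at h
    rw [powerMap_of_notMem m₀ _ _ h]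
    refine (he.eq_iff _).2 ?_
    -- With no step crossing j, all values of φ lie on the side of φ(0): the partial sum is 1 if
    -- they are at most j, and 0 if they are larger.
    by_cases h0 : φ.toOrderHom 0 < Fin.succ j
    · have hall : ∀ i, φ.toOrderHom i < Fin.succ j := by
        intro i
        induction i using Fin.induction with
        | zero => exact h0
        | succ i ih => exact not_le.1 fun h' ↦ h i ⟨ih, h'⟩
      rintro ⟨-, h2⟩
      refine absurd (Subtype.mk_lt_mk.1 h2) (not_lt.2 (le_of_eq ?_))
      rw [partialSum_map, ← stdSimplex.sum_eq_one t]
      refine (Finset.sum_congr ?_ fun _ _ ↦ rfl).symm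
      ext i
      simpa using Fin.lt_def.1 (hall i)
    · rintro ⟨h1, -⟩
      refine absurd (Subtype.mk_lt_mk.1 h1) (not_lt.2 (le_of_eq ?_))
      rw [partialSum_map]
      refine Finset.sum_eq_zero fun i hi ↦ absurd ?_ h0
      simp only [Finset.mem_filter, Finset.mem_univ, true_and] at hi
      exact (φ.toOrderHom.monotone (Fin.zero_le i)).trans_lt (Fin.lt_def.2 hi)

/-- The point of a simplex underlying a point of `Δ^m`. -/
def simplexPoint {X : SimplexCategory} (x : simplexSpace.{u}.obj X) :
    stdSimplex ℝ (Fin (X.len + 1)) :=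
  (WithGeneratedByTopology.equiv (X := compHausFamily.{u})
    (Y := ULift (stdSimplex ℝ (Fin (X.len + 1)))) x).down

theorem continuous_simplexPoint {X : SimplexCategory} :
    Continuous (simplexPoint.{u} (X := X)) :=
  continuous_uliftDown.comp WithGeneratedByTopology.continuous_equiv

theorem simplexPoint_injective {X : SimplexCategory} :
    Function.Injective (simplexPoint.{u} (X := X)) := fun _ _ h ↦ ULift.down_injective h

/-- The point of `Δ^m` given by a point of a simplex. -/
def ofSimplexPoint {X : SimplexCategory} (t : stdSimplex ℝ (Fin (X.len + 1))) :
    simplexSpace.{u}.obj X :=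
  (WithGeneratedByTopology.equiv (X := compHausFamily.{u})
    (Y := ULift (stdSimplex ℝ (Fin (X.len + 1))))).symm (ULift.up t)

theorem simplexPoint_map {X Y : SimplexCategory} (φ : X ⟶ Y) (x : simplexSpace.{u}.obj X) :
    simplexPoint ((simplexSpace.map φ).hom x) = stdSimplex.map φ.toOrderHom (simplexPoint x) :=
  rfl

/-- The generic point of a simplex with given partial sums. -/
theorem exists_generic_point (V : Finset ℝ) (hV : ∀ x ∈ V, x ∈ Set.Ioo (0 : ℝ) 1) :
    ∃ (t : stdSimplex ℝ (Fin (V.card + 1))),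
      (∀ (k : ℕ) (t' : stdSimplex ℝ (Fin (k + 1))),
        (∀ j < k, partialSum t' (j + 1) ∈ insert 0 (insert 1 V)) →
          ∃ φ : Fin (V.card + 1) →o Fin (k + 1), stdSimplex.map φ t = t') ∧
      (∀ x ∈ V, ∃ j : Fin V.card, partialSum t (j + 1) = x) ∧
      (∀ j : Fin V.card, partialSum t (j + 1) ∈ Set.Ioo (0 : ℝ) 1) ∧
      Function.Injective fun j : Fin V.card ↦ partialSum t (j + 1) := by
  obtain ⟨v, hv, h0, h1, h⟩ := exists_strictMono_range V hV
  have hp := partialSum_simplexOfPartialSums hv.monotone h0 h1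
  refine ⟨simplexOfPartialSums v hv.monotone h0 h1, fun k t' ht' ↦ ?_, fun x hx ↦ ?_, fun j ↦ ?_,
    fun i j hij ↦ ?_⟩
  · refine exists_map_simplexOfPartialSums t' hv h0 h1 fun j hj ↦ ?_
    have := ht' j hj
    simp only [Finset.mem_insert] at this
    rcases this with h' | h' | h'
    · exact ⟨0, by rw [h', h0]⟩
    · exact ⟨Fin.last _, by rw [h', h1]⟩
    · exact h _ h'
  · obtain ⟨⟨l, hl⟩, rfl⟩ := h x hx
    have hl0 : l ≠ 0 := by
      rintro rfl
      have := (hV _ hx).1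
      exact this.ne' h0
    have hl1 : l ≠ V.card + 1 := by
      rintro rfl
      have := (hV _ hx).2
      exact this.ne h1
    -- The coordinate j uses the partial sum of index j + 1; l - 1 is admissible because x lies
    -- strictly between 0 and 1.
    refine ⟨⟨l - 1, by omega⟩, ?_⟩
    rw [hp _ (by simp only; omega)]
    congr 2
    simp only
    omega
  · rw [hp _ (by omega)]
    refine ⟨?_, ?_⟩
    · rw [← h0]
      exact hv (Fin.lt_def.2 (by simp))
    · rw [← h1]
      exact hv (Fin.lt_def.2 (by simp))
  · simp only at hij
    rw [hp _ (by omega), hp _ (by omega)] at hij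
    have := hv.injective hij
    rw [Fin.ext_iff] at this ⊢
    simpa using this

include he in
theorem simplexCoord_generic {N : ℕ} {t : stdSimplex ℝ (Fin (N + 1))}
    (h : ∀ j : Fin N, partialSum t (j + 1) ∈ Set.Ioo (0 : ℝ) 1)
    (hi : Function.Injective fun j : Fin N ↦ partialSum t (j + 1)) :
    Function.Injective (simplexCoord e (SimplexCategory.mk N) t) ∧
      ∀ i, simplexCoord e (SimplexCategory.mk N) t i ≠ m₀ := by
  refine ⟨fun i j hij ↦ ?_, fun i h' ↦ (he.eq_iff _).1 h' ⟨?_, ?_⟩⟩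
  · have := he.injOn (x₁ := ⟨partialSum t (i + 1), partialSum_mem_Icc t _⟩)
      (x₂ := ⟨partialSum t (j + 1), partialSum_mem_Icc t _⟩) ?_ ?_ hij
    · exact hi (congrArg Subtype.val this)
    · exact ⟨Subtype.mk_lt_mk.2 (h i).1, Subtype.mk_lt_mk.2 (h i).2⟩
    · exact ⟨Subtype.mk_lt_mk.2 (h j).1, Subtype.mk_lt_mk.2 (h j).2⟩
  · exact Subtype.mk_lt_mk.2 (h i).1
  · exact Subtype.mk_lt_mk.2 (h i).2

/-- The coordinates of the simplices in the circle. -/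
noncomputable def simplexCoords : CellCoords segal simplexSpace.{u} M m₀ where
  coord X x := simplexCoord e X (simplexPoint x)
  continuous_coord X := continuous_pi fun j ↦ he.continuous.comp
    (((continuous_partialSum _).comp continuous_simplexPoint).subtype_mk _)
  naturality {X Y} f x := by
    rw [simplexPoint_map]
    exact he.simplexCoord_map f _
  exists_refinement := by
    intro X X' x x'
    classical
    -- The common subdivision of the interval by the cut points of both simplices. Removing 0 and 1
    -- keeps the refining point generic.
    let V : Finset ℝ := ((Finset.univ.image fun j : Fin X.len ↦
      partialSum (simplexPoint x) (j + 1)) ∪ (Finset.univ.image fun j : Fin X'.len ↦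
      partialSum (simplexPoint x') (j + 1))) \ {0, 1}
    obtain ⟨t, ht, -, h1, h2⟩ := exists_generic_point V (by
      intro y hy
      simp only [V, Finset.mem_sdiff, Finset.mem_union, Finset.mem_image, Finset.mem_univ,
        true_and, Finset.mem_insert, Finset.mem_singleton, not_or] at hy
      have : y ∈ Set.Icc (0 : ℝ) 1 := by
        obtain ⟨⟨j, rfl⟩ | ⟨j, rfl⟩, -⟩ := hy <;> exact partialSum_mem_Icc _ _
      exact ⟨lt_of_le_of_ne this.1 (Ne.symm hy.2.1), lt_of_le_of_ne this.2 hy.2.2⟩)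
    obtain ⟨φ, hφ⟩ := ht X.len (simplexPoint x) (by
      intro j hj
      have : ∃ a : Fin X.len, partialSum (simplexPoint x) (a + 1) =
        partialSum (simplexPoint x) (j + 1) := ⟨⟨j, hj⟩, rfl⟩
      simp only [V, Finset.mem_insert, Finset.mem_sdiff, Finset.mem_union, Finset.mem_image,
        Finset.mem_univ, true_and, Finset.mem_singleton]
      tauto)
    obtain ⟨φ', hφ'⟩ := ht X'.len (simplexPoint x') (by
      intro j hj
      have : ∃ a : Fin X'.len, partialSum (simplexPoint x') (a + 1) =
        partialSum (simplexPoint x') (j + 1) := ⟨⟨j, hj⟩, rfl⟩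
      simp only [V, Finset.mem_insert, Finset.mem_sdiff, Finset.mem_union, Finset.mem_image,
        Finset.mem_univ, true_and, Finset.mem_singleton]
      tauto)
    exact ⟨SimplexCategory.mk V.card, ofSimplexPoint t, SimplexCategory.Hom.mk φ,
      SimplexCategory.Hom.mk φ', simplexPoint_injective hφ, simplexPoint_injective hφ',
      he.simplexCoord_generic h1 h2⟩
  exists_cover := by
    intro k
    classical
    refine ⟨SimplexCategory.mk k, CompHaus.of (ULift.{u} (stdSimplex ℝ (Fin (k + 1)))),
      fun y ↦ ofSimplexPoint y.down, continuous_kify_iff.2 continuous_id, fun W hW hm ↦ ?_⟩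
    have hex (w : W) : ∃ x : Set.Ioo (0 : ℝ) 1, e ⟨x, x.2.1.le, x.2.2.le⟩ = w := by
      have hw : w.1 ≠ m₀ := fun h ↦ hm (h ▸ w.2)
      obtain ⟨x, hx⟩ := he.exists_eq w hw
      have hx' : 0 < x ∧ x < 1 := by
        by_contra h'
        exact hw (hx.symm.trans ((he.eq_iff x).2 h'))
      exact ⟨⟨x, Subtype.coe_lt_coe.2 hx'.1, Subtype.coe_lt_coe.2 hx'.2⟩, hx⟩
    choose g hg using hex
    have : Infinite (Set.Ioo (0 : ℝ) 1) := (Set.Ioo_infinite one_pos).to_subtype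
    -- The whole simplex Δ^k must serve every W at once, so the lifted points are padded by further
    -- interior points to exactly k cuts.
    obtain ⟨V', hV', hk⟩ := Infinite.exists_superset_card_eq (W.attach.image g) k
      (Finset.card_image_le.trans (by simpa using hW))
    rw [← Finset.card_map (Function.Embedding.subtype _)] at hk
    subst hk
    obtain ⟨t, -, ht, -, -⟩ := exists_generic_point (V'.map (Function.Embedding.subtype _)) (by
      intro x hx
      obtain ⟨y, -, rfl⟩ := Finset.mem_map.1 hx
      exact y.2)
    refine ⟨ULift.up t, fun w hw ↦ ?_⟩
    obtain ⟨j, hj⟩ := ht (g ⟨w, hw⟩) (Finset.mem_map.2 ⟨g ⟨w, hw⟩,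
      hV' (Finset.mem_image.2 ⟨⟨w, hw⟩, Finset.mem_attach _ _, rfl⟩), rfl⟩)
    refine ⟨j, Eq.trans ?_ (hg ⟨w, hw⟩)⟩
    exact congrArg e (Subtype.ext hj)

end IsCollapse

/-! ### Cells of wreath products -/

section Smash

variable {M₁ M M' : Type u} {m₁ : M₁} {m₀ : M} {m₀' : M'} {μ : M₁ × M → M'}

/-- The family `μ(x_i, y_r)`, indexed by the pairs `(i, r)`. -/
def smashCoord (μ : M₁ × M → M') {a b : Gam} (x : Fin a.card → M₁) (y : Fin b.card → M)
    (q : Fin (∑ _ : Fin a.card, b.card)) : M' :=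
  μ (x (finSigmaFinEquiv.symm q).1, y (finSigmaFinEquiv.symm q).2)

/-- The operator χ acts as φ × ψ on pairs. A pair hit by no pair misses φ or ψ in one component;
that component is then a base point, and μ collapses it. -/
theorem smashCoord_powerMap (hμ : ∀ p, μ p = m₀' ↔ ¬ (p.1 ≠ m₁ ∧ p.2 ≠ m₀)) {a b a' b' : Gam}
    (φ : a ⟶ a') (ψ : b ⟶ b')
    (χ : Gam.mk (∑ _ : Fin a.card, b.card) ⟶ Gam.mk (∑ _ : Fin a'.card, b'.card))
    (hχ : ∀ p q, q ∈ χ.sets p ↔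
      (finSigmaFinEquiv.symm q).1 ∈ φ.sets (finSigmaFinEquiv.symm p).1 ∧
      (finSigmaFinEquiv.symm q).2 ∈ ψ.sets (finSigmaFinEquiv.symm p).2)
    (x : Fin a.card → M₁) (y : Fin b.card → M) :
    smashCoord μ (powerMap m₁ φ x) (powerMap m₀ ψ y) = powerMap m₀' χ (smashCoord μ x y) := by
  funext q
  by_cases h : ∃ p, q ∈ χ.sets p
  · obtain ⟨p, hp⟩ := h
    rw [powerMap_of_mem _ _ _ hp, smashCoord, powerMap_of_mem _ _ _ ((hχ p q).1 hp).1,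
      powerMap_of_mem _ _ _ ((hχ p q).1 hp).2, smashCoord]
  · push Not at h
    rw [powerMap_of_notMem _ _ _ h, smashCoord, hμ]
    rintro ⟨h1, h2⟩
    by_cases hi : ∃ i, (finSigmaFinEquiv.symm q).1 ∈ φ.sets i
    · by_cases hr : ∃ r, (finSigmaFinEquiv.symm q).2 ∈ ψ.sets r
      · obtain ⟨i, hi⟩ := hi
        obtain ⟨r, hr⟩ := hr
        refine h (finSigmaFinEquiv (n := fun _ : Fin a.card ↦ b.card) ⟨i, r⟩) ((hχ _ _).2 ?_)
        rw [Equiv.symm_apply_apply]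
        exact ⟨hi, hr⟩
      · push Not at hr
        exact h2 (powerMap_of_notMem _ _ _ hr)
    · push Not at hi
      exact h1 (powerMap_of_notMem _ _ _ hi)

variable [TopologicalSpace M₁] [TopologicalSpace M] [TopologicalSpace M']

theorem continuous_smashCoord (hμ : Continuous μ) {a b : Gam} :
    Continuous fun p : (Fin a.card → M₁) × (Fin b.card → M) ↦ smashCoord μ p.1 p.2 :=
  continuous_pi fun _ ↦ hμ.comp (((continuous_apply _).comp continuous_fst).prodMk
    ((continuous_apply _).comp continuous_snd))

/-- Pairs of non-base points lie where μ is injective and avoids the base point, so genericity of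
both factors passes to the product family. -/
theorem smashCoord_generic (hμ : IsCollapse {p : M₁ × M | p.1 ≠ m₁ ∧ p.2 ≠ m₀} m₀' μ) {a b : Gam}
    {x : Fin a.card → M₁} {y : Fin b.card → M} (hx : Function.Injective x) (hx' : ∀ i, x i ≠ m₁)
    (hy : Function.Injective y) (hy' : ∀ i, y i ≠ m₀) :
    Function.Injective (smashCoord μ x y) ∧ ∀ q, smashCoord μ x y q ≠ m₀' := by
  refine ⟨fun p q h ↦ ?_, fun q h ↦ (hμ.eq_iff _).1 h ⟨hx' _, hy' _⟩⟩
  have e := hμ.injOn ⟨hx' _, hy' _⟩ ⟨hx' _, hy' _⟩ h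
  have e1 := hx (congrArg Prod.fst e)
  have e2 := hy (congrArg Prod.snd e)
  apply finSigmaFinEquiv.symm.injective
  exact Sigma.ext e1 (heq_of_eq e2)

end Smash

/-! ### Diagonal cells and coordinates for Δ ≀ C -/

section WreathCells

variable {C : Type} [SmallCategory C]

/-- The cells of `Δ ≀ C` associated with cells of `C`. -/
noncomputable abbrev wreathCell (G : C ⥤ CGTop.{u}) : Wreath segal C ⥤ CGTop.{u} :=
  yoneda (C := Wreath segal C) ⋙
    (Functor.whiskeringLeft (SimplexCategory × C)ᵒᵖ (Wreath segal C)ᵒᵖ Type).obj (diag C).op ⋙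
      realizeSets (simplexSpace.prod G ⋙ kProd)

/-- The composite `Δ ≀ C → Γ ≀ Γ → Γ` for a functor `C → Γ`. -/
noncomputable abbrev wreathAssembly (γ : C ⥤ Gam) : Wreath segal C ⥤ Gam :=
  Wreath.toGam segal C ⋙ Wreath.mapLabel (𝟭 Gam) γ ⋙ disjointSum

variable {G : C ⥤ CGTop.{u}} {γ : C ⥤ Gam} {T T' : Wreath segal C}

/-- The point of the cell of `T` given by an operator `δ([m], c) → T` and a point of
`Δ^m × G(c)`. -/
noncomputable def wreathCellMk (P : SimplexCategory × C) (h : (diag C).obj P ⟶ T)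
    (t : simplexSpace.{u}.obj P.1) (s : G.obj P.2) : (wreathCell G).obj T :=
  tensorMk (F := ((diag C).op ⋙ yoneda.obj T) ⋙ discreteSpace.{u})
    (G := simplexSpace.prod G ⋙ kProd) P
    ((WithGeneratedByTopology.equiv (X := compHausFamily.{u})
      (Y := TopCat.discrete.obj (ULift.{u} ((diag C).obj P ⟶ T)))).symm (ULift.up h))
    ((WithGeneratedByTopology.equiv (X := compHausFamily.{u})
      (Y := simplexSpace.{u}.obj P.1 × G.obj P.2)).symm (t, s))

theorem wreathCellMk_surjective (x : (wreathCell G).obj T) :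
    ∃ P h t s, wreathCellMk (T := T) P h t s = x := by
  obtain ⟨P, h, p, rfl⟩ := tensorMk_surjective
    (F := ((diag C).op ⋙ yoneda.obj T) ⋙ discreteSpace.{u})
    (G := simplexSpace.prod G ⋙ kProd) x
  exact ⟨P, ULift.down h, p.1, p.2, rfl⟩

theorem wreathCellMk_glue {P P' : SimplexCategory × C} (f : P ⟶ P') (h : (diag C).obj P' ⟶ T)
    (t : simplexSpace.{u}.obj P.1) (s : G.obj P.2) :
    wreathCellMk P ((diag C).map f ≫ h) t s =
      wreathCellMk P' h ((simplexSpace.map f.1).hom t) ((G.map f.2).hom s) :=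
  tensorMk_glue (F := ((diag C).op ⋙ yoneda.obj T) ⋙ discreteSpace.{u})
    (G := simplexSpace.prod G ⋙ kProd) f _ _

theorem wreathCell_map_mk (g : T ⟶ T') {P : SimplexCategory × C} (h : (diag C).obj P ⟶ T)
    (t : simplexSpace.{u}.obj P.1) (s : G.obj P.2) :
    ((wreathCell G).map g).hom (wreathCellMk P h t s) = wreathCellMk P (h ≫ g) t s := rfl

theorem continuous_wreathCellMk {Z : Type*} [TopologicalSpace Z]
    [IsGeneratedBy compHausFamily.{u} Z] (P : SimplexCategory × C) (h : (diag C).obj P ⟶ T)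
    {a : Z → simplexSpace.{u}.obj P.1} {b : Z → G.obj P.2} (ha : Continuous a)
    (hb : Continuous b) : Continuous fun z ↦ wreathCellMk P h (a z) (b z) :=
  continuous_tensorMk (F := ((diag C).op ⋙ yoneda.obj T) ⋙ discreteSpace.{u})
    (G := simplexSpace.prod G ⋙ kProd) P continuous_const
    (continuous_kify_iff (Y := TopCat.of (simplexSpace.{u}.obj P.1 × G.obj P.2)).2
      (ha.prodMk hb))

/-- The operators into T form a discrete space, so continuity may be checked with the operator
fixed, on Δ^m × G(c) alone. -/
theorem continuous_of_wreathCellMk {Z : Type u} [TopologicalSpace Z]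
    {g : (wreathCell G).obj T → Z}
    (hg : ∀ P h, Continuous fun p : simplexSpace.{u}.obj P.1 × G.obj P.2 ↦
      g (wreathCellMk P h p.1 p.2)) : Continuous g := by
  refine (continuous_tensor_iff (F := ((diag C).op ⋙ yoneda.obj T) ⋙ discreteSpace.{u})
    (G := simplexSpace.prod G ⋙ kProd)).2 fun P L φ ↦ ?_
  let a : compHausFamily.{u} L → TopCat.discrete.obj (ULift.{u} ((diag C).obj P ⟶ T)) :=
    fun y ↦ WithGeneratedByTopology.equiv (X := compHausFamily.{u})
      (Y := TopCat.discrete.obj (ULift.{u} ((diag C).obj P ⟶ T))) (φ y).1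
  have ha : Continuous a := WithGeneratedByTopology.continuous_equiv.comp φ.continuous.fst
  let b : compHausFamily.{u} L → simplexSpace.{u}.obj P.1 × G.obj P.2 :=
    fun y ↦ WithGeneratedByTopology.equiv (X := compHausFamily.{u})
      (Y := simplexSpace.{u}.obj P.1 × G.obj P.2) (φ y).2
  have hb : Continuous b := WithGeneratedByTopology.continuous_equiv.comp φ.continuous.snd
  have h2 : Continuous fun y : TopCat.discrete.obj (ULift.{u} ((diag C).obj P ⟶ T)) ×
      compHausFamily.{u} L ↦ g (wreathCellMk P (ULift.down y.1) (b y.2).1 (b y.2).2) :=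
    continuous_prod_of_discrete_left.2 fun h ↦ (hg P (ULift.down h)).comp hb
  exact h2.comp (ha.prodMk continuous_id)

variable {M₁ M M' : Type u} [TopologicalSpace M₁] [TopologicalSpace M] {m₁ : M₁}
  {m₀ : M} {m₀' : M'} {μ : M₁ × M → M'}

namespace CellCoords

variable (D₁ : CellCoords segal simplexSpace.{u} M₁ m₁) (D : CellCoords γ G M m₀)

/-- The coordinates of the points of the diagonal cells of a wreath product. -/
def diagCoord (μ : M₁ × M → M') (P : SimplexCategory × C) (t : simplexSpace.{u}.obj P.1)
    (s : G.obj P.2) : Fin ((wreathAssembly γ).obj ((diag C).obj P)).card → M' :=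
  smashCoord μ (D₁.coord P.1 t) (D.coord P.2 s)

/-- The assembled image of a diagonal morphism (φ, ψ) sends (i, r) to φ(i) × ψ(r). This is the
compatibility needed to descend the coordinates to the tensor product defining the cell. -/
theorem diagCoord_map (hμ : ∀ p, μ p = m₀' ↔ ¬ (p.1 ≠ m₁ ∧ p.2 ≠ m₀))
    {P P' : SimplexCategory × C} (f : P ⟶ P') (t : simplexSpace.{u}.obj P.1) (s : G.obj P.2) :
    D₁.diagCoord D μ P' ((simplexSpace.map f.1).hom t) ((G.map f.2).hom s) =
      powerMap m₀' ((wreathAssembly γ).map ((diag C).map f)) (D₁.diagCoord D μ P t s) := by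
  unfold diagCoord
  rw [D₁.naturality, D.naturality]
  refine smashCoord_powerMap hμ (segal.map f.1) (γ.map f.2)
    ((wreathAssembly γ).map ((diag C).map f)) (fun p q ↦ ?_) _ _
  exact ⟨fun ⟨h, h'⟩ ↦ ⟨h, h'⟩, fun ⟨h, h'⟩ ↦ ⟨h, h'⟩⟩

/-- The coordinates of the cells of a wreath product. -/
noncomputable def wreathCoord (μ : M₁ × M → M') (m₀' : M')
    (hμ : ∀ p, μ p = m₀' ↔ ¬ (p.1 ≠ m₁ ∧ p.2 ≠ m₀)) (T : Wreath segal C) :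
    (wreathCell G).obj T → Fin ((wreathAssembly γ).obj T).card → M' :=
  tensorLift (F := ((diag C).op ⋙ yoneda.obj T) ⋙ discreteSpace.{u})
    (G := simplexSpace.prod G ⋙ kProd)
    (fun P h p ↦ powerMap m₀' ((wreathAssembly γ).map
        (show (diag C).obj P ⟶ T from ULift.down h))
      (D₁.diagCoord D μ P (WithGeneratedByTopology.equiv (X := compHausFamily.{u})
          (Y := simplexSpace.{u}.obj P.1 × G.obj P.2) p).1
        (WithGeneratedByTopology.equiv (X := compHausFamily.{u})
          (Y := simplexSpace.{u}.obj P.1 × G.obj P.2) p).2)) (by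
    intro P P' f h p
    have e := D₁.diagCoord_map D hμ f
      (WithGeneratedByTopology.equiv (X := compHausFamily.{u})
        (Y := simplexSpace.{u}.obj P.1 × G.obj P.2) p).1
      (WithGeneratedByTopology.equiv (X := compHausFamily.{u})
        (Y := simplexSpace.{u}.obj P.1 × G.obj P.2) p).2
    have key (h : (diag C).obj P' ⟶ T) (x) : powerMap m₀'
        ((wreathAssembly γ).map ((diag C).map f ≫ h)) x = powerMap m₀' ((wreathAssembly γ).map h)
          (powerMap m₀' ((wreathAssembly γ).map ((diag C).map f)) x) := by
      rw [← powerMap_comp, ← (wreathAssembly γ).map_comp]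
    exact (key h.down _).trans (congrArg (powerMap m₀' ((wreathAssembly γ).map
        (show (diag C).obj P' ⟶ T from ULift.down h))) e.symm))

theorem wreathCoord_mk (hμ : ∀ p, μ p = m₀' ↔ ¬ (p.1 ≠ m₁ ∧ p.2 ≠ m₀))
    (P : SimplexCategory × C) (h : (diag C).obj P ⟶ T)
    (t : simplexSpace.{u}.obj P.1) (s : G.obj P.2) :
    D₁.wreathCoord D μ m₀' hμ T (wreathCellMk P h t s) =
      powerMap m₀' ((wreathAssembly γ).map h) (D₁.diagCoord D μ P t s) := rfl

theorem wreathCoord_mk_id (hμ : ∀ p, μ p = m₀' ↔ ¬ (p.1 ≠ m₁ ∧ p.2 ≠ m₀))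
    (P : SimplexCategory × C) (t : simplexSpace.{u}.obj P.1) (s : G.obj P.2) :
    D₁.wreathCoord D μ m₀' hμ _ (wreathCellMk P (𝟙 _) t s) = D₁.diagCoord D μ P t s := by
  rw [wreathCoord_mk, (wreathAssembly γ).map_id, powerMap_id]

variable [TopologicalSpace M']

theorem continuous_diagCoord (hμc : Continuous μ) (P : SimplexCategory × C) :
    Continuous fun p : simplexSpace.{u}.obj P.1 × G.obj P.2 ↦ D₁.diagCoord D μ P p.1 p.2 :=
  (continuous_smashCoord hμc).comp ((D₁.continuous_coord P.1).prodMap (D.continuous_coord P.2))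

theorem continuous_wreathCoord (hμ : ∀ p, μ p = m₀' ↔ ¬ (p.1 ≠ m₁ ∧ p.2 ≠ m₀))
    (hμc : Continuous μ) (T : Wreath segal C) : Continuous (D₁.wreathCoord D μ m₀' hμ T) :=
  continuous_of_wreathCellMk fun P h ↦
    (continuous_powerMap m₀' ((wreathAssembly γ).map h)).comp (D₁.continuous_diagCoord D hμc P)

/-- The coordinates of the cells of a wreath product. -/
noncomputable def wreath (hμ : IsCollapse {p : M₁ × M | p.1 ≠ m₁ ∧ p.2 ≠ m₀} m₀' μ) :
    CellCoords (wreathAssembly γ) (wreathCell G) M' m₀' where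
  coord T := D₁.wreathCoord D μ m₀' hμ.eq_iff T
  continuous_coord T := D₁.continuous_wreathCoord D hμ.eq_iff hμ.continuous T
  naturality {T T'} f x := by
    obtain ⟨P, h, t, s, rfl⟩ := wreathCellMk_surjective x
    rw [wreathCell_map_mk, wreathCoord_mk, wreathCoord_mk, (wreathAssembly γ).map_comp,
      powerMap_comp]
  exists_refinement := by
    intro T T' x x'
    obtain ⟨P, h, t, s, rfl⟩ := wreathCellMk_surjective x
    obtain ⟨P', h', t', s', rfl⟩ := wreathCellMk_surjective x'
    -- The simplex and C factors are refined separately; the two generic points combine to one in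
    -- the diagonal cell of (X, c).
    obtain ⟨X, t₀, φ, φ', rfl, rfl, h1, h2⟩ := D₁.exists_refinement _ _ t t'
    obtain ⟨c, s₀, ψ, ψ', rfl, rfl, h3, h4⟩ := D.exists_refinement _ _ s s'
    refine ⟨(diag C).obj (X, c), wreathCellMk (X, c) (𝟙 _) t₀ s₀,
      (diag C).map (Y := P) (φ, ψ) ≫ h, (diag C).map (Y := P') (φ', ψ') ≫ h', ?_, ?_, ?_⟩
    · rw [wreathCell_map_mk, Category.id_comp]
      exact wreathCellMk_glue (P := (X, c)) (P' := P) (φ, ψ) h t₀ s₀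
    · rw [wreathCell_map_mk, Category.id_comp]
      exact wreathCellMk_glue (P := (X, c)) (P' := P') (φ', ψ') h' t₀ s₀
    · rw [wreathCoord_mk_id]
      exact smashCoord_generic hμ h1 h2 h3 h4
  exists_cover := by
    intro k
    classical
    obtain ⟨X, K₁, κ₁, hκ₁, h₁⟩ := D₁.exists_cover k
    obtain ⟨c, K, κ, hκ, h⟩ := D.exists_cover k
    refine ⟨(diag C).obj (X, c), CompHaus.of (K₁ × K),
      fun y ↦ wreathCellMk (X, c) (𝟙 _) (κ₁ y.1) (κ y.2),
      continuous_wreathCellMk (Z := K₁ × K) (X, c) (𝟙 _) (hκ₁.comp continuous_fst)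
        (hκ.comp continuous_snd), fun W hW hm ↦ ?_⟩
    have hex (w : W) : ∃ p : M₁ × M, μ p = w ∧ p.1 ≠ m₁ ∧ p.2 ≠ m₀ := by
      have hw : w.1 ≠ m₀' := fun h ↦ hm (h ▸ w.2)
      obtain ⟨p, hp⟩ := hμ.exists_eq w hw
      refine ⟨p, hp, ?_⟩
      by_contra h'
      exact hw (hp.symm.trans ((hμ.eq_iff p).2 h'))
    choose g hg hg₁ hg₀ using hex
    -- Lifting W along μ, the first components form a set of at most k points, and so do the second.
    -- The diagonal cell has all pairs as coordinates, in particular those needed.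
    obtain ⟨y₁, hy₁⟩ := h₁ (W.attach.image fun w ↦ (g w).1)
      (Finset.card_image_le.trans (by simpa using hW)) (by
        simp only [Finset.mem_image, not_exists, not_and]
        exact fun w _ ↦ hg₁ w)
    obtain ⟨y, hy⟩ := h (W.attach.image fun w ↦ (g w).2)
      (Finset.card_image_le.trans (by simpa using hW)) (by
        simp only [Finset.mem_image, not_exists, not_and]
        exact fun w _ ↦ hg₀ w)
    refine ⟨(y₁, y), fun w hw ↦ ?_⟩
    obtain ⟨i, hi⟩ := hy₁ _ (Finset.mem_image_of_mem _ (Finset.mem_attach W ⟨w, hw⟩))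
    obtain ⟨r, hr⟩ := hy _ (Finset.mem_image_of_mem _ (Finset.mem_attach W ⟨w, hw⟩))
    refine ⟨finSigmaFinEquiv (n := fun _ : Fin (segal.obj X).card ↦ (γ.obj c).card) ⟨i, r⟩, ?_⟩
    refine (congrFun (D₁.wreathCoord_mk_id D hμ.eq_iff (X, c) (κ₁ y₁) (κ y)) _).trans ?_
    rw [diagCoord, smashCoord, Equiv.symm_apply_apply]
    exact (congrArg μ (Prod.ext hi hr)).trans (hg ⟨w, hw⟩)

end CellCoords

end WreathCells

/-! ### Spheres -/

/-- A homeomorphism of an open subset `U` of a compact space with the complement of a point of a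
compact space extends to a map which collapses the complement of `U` to that point. -/
theorem exists_isCollapse {X S : Type*} [TopologicalSpace X] [CompactSpace X] [T2Space X]
    [TopologicalSpace S] [CompactSpace S] [T2Space S] {U : Set X} (hU : IsOpen U) (s₀ : S)
    (e : U ≃ₜ ({s₀}ᶜ : Set S)) : ∃ f : X → S, IsCollapse U s₀ f := by
  classical
  let f : X → S := fun x ↦ if h : x ∈ U then e ⟨x, h⟩ else s₀
  have hf (x : U) : f x = e x := dif_pos x.2
  have hf' (x : X) (hx : x ∉ U) : f x = s₀ := dif_neg hx
  refine ⟨f, ⟨continuous_def.2 fun O hO ↦ ?_, fun x ↦ ⟨fun h hx ↦ ?_, hf' x⟩, fun x hx y hy h ↦ ?_,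
    fun s hs ↦ ⟨e.symm ⟨s, hs⟩, by rw [hf, e.apply_symm_apply]⟩⟩⟩
  · by_cases hs : s₀ ∈ O
    · have h : (f ⁻¹' O)ᶜ = Subtype.val '' (e.symm '' (Subtype.val ⁻¹' Oᶜ)) := by
        ext x
        constructor
        · intro hx
          have hxU : x ∈ U := by
            by_contra h
            exact hx (show f x ∈ O by rwa [hf' x h])
          refine ⟨⟨x, hxU⟩, ⟨e ⟨x, hxU⟩, ?_, e.symm_apply_apply _⟩, rfl⟩
          rw [Set.mem_preimage, ← hf ⟨x, hxU⟩]
          exact hx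
        · rintro ⟨_, ⟨y, hy, rfl⟩, rfl⟩
          change f _ ∉ O
          rw [hf, e.apply_symm_apply]
          exact hy
      rw [← isClosed_compl_iff, h]
      refine IsCompact.isClosed ((IsCompact.image ?_ e.symm.continuous).image
        continuous_subtype_val)
      rw [Subtype.isCompact_iff, Subtype.image_preimage_coe, Set.inter_eq_self_of_subset_right]
      · exact hO.isClosed_compl.isCompact
      · rintro x hx rfl
        exact hx hs
    · have h : f ⁻¹' O = Subtype.val '' (e ⁻¹' (Subtype.val ⁻¹' O)) := by
        ext x
        constructor
        · intro hx
          have hxU : x ∈ U := by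
            by_contra h
            exact hs (hf' x h ▸ hx)
          refine ⟨⟨x, hxU⟩, ?_, rfl⟩
          rw [Set.mem_preimage, Set.mem_preimage, ← hf ⟨x, hxU⟩]
          exact hx
        · rintro ⟨y, hy, rfl⟩
          rw [Set.mem_preimage, hf]
          exact hy
      rw [h]
      exact hU.isOpenMap_subtype_val _
        ((hO.preimage continuous_subtype_val).preimage e.continuous)
  · exact (e ⟨x, hx⟩).2 ((hf ⟨x, hx⟩).symm.trans h)
  · rw [hf ⟨x, hx⟩, hf ⟨y, hy⟩] at h
    exact congrArg Subtype.val (e.injective (Subtype.ext h))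

/-- The underlying space of `S^n` is the unit sphere. -/
noncomputable def sphereHomeomorph (n : ℕ) :
    sphereSpace.{u} n ≃ₜ Metric.sphere (0 : EuclideanSpace ℝ (Fin (n + 1))) 1 :=
  (IsGeneratedBy.homeomorph (X := compHausFamily.{u})
    (Y := ULift.{u} (Metric.sphere (0 : EuclideanSpace ℝ (Fin (n + 1))) 1))).trans
      Homeomorph.ulift

instance (n : ℕ) : CompactSpace (sphereSpace.{u} n) := (sphereHomeomorph n).symm.compactSpace

instance (n : ℕ) : T2Space (sphereSpace.{u} n) := (sphereHomeomorph n).symm.t2Space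

/-- The stereographic projection. -/
noncomputable def sphereComplHomeomorph (n : ℕ) :
    ({sphereBase n}ᶜ : Set (sphereSpace.{u} n)) ≃ₜ EuclideanSpace ℝ (Fin n) :=
  haveI : Fact (Module.finrank ℝ (EuclideanSpace ℝ (Fin (n + 1))) = n + 1) := ⟨by simp⟩
  let v := sphereHomeomorph n (sphereBase n)
  ((sphereHomeomorph n).subtype (q := fun x ↦ x ∈ (stereographic' n v).source) fun x ↦ by
    rw [stereographic'_source]
    exact not_congr (sphereHomeomorph n).injective.eq_iff.symm).trans
      ((stereographic' n v).toHomeomorphSourceTarget.trans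
        ((Homeomorph.setCongr (stereographic'_target v)).trans (Homeomorph.Set.univ _)))

/-- The interior of the unit interval is homeomorphic to the interior of the unit ball. -/
noncomputable def unitIntervalInteriorHomeomorph :
    {x : unitInterval | 0 < x ∧ x < 1} ≃ₜ Metric.ball (0 : ℝ) 1 where
  toFun x := ⟨2 * (x.1 : ℝ) - 1, by
    have h0 : (0 : ℝ) < x.1 := x.2.1
    have h1 : (x.1 : ℝ) < 1 := x.2.2
    rw [Real.ball_eq_Ioo]
    constructor <;> linarith⟩
  invFun y := ⟨⟨(y + 1) / 2, by
    have h := y.2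
    rw [mem_ball_zero_iff, Real.norm_eq_abs, abs_lt] at h
    obtain ⟨h0, h1⟩ := h
    constructor <;> linarith⟩, by
    have h := y.2
    rw [mem_ball_zero_iff, Real.norm_eq_abs, abs_lt] at h
    obtain ⟨h0, h1⟩ := h
    constructor
    · exact Subtype.mk_lt_mk.2 (by linarith)
    · exact Subtype.mk_lt_mk.2 (by linarith)⟩
  left_inv x := by
    ext
    simp
  right_inv y := by
    ext
    simp
    ring
  continuous_toFun := by fun_prop
  continuous_invFun := by fun_prop

/-- The open interval is homeomorphic to ℝ, and so is the circle without its base point; the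
collapse realises S^1 as I/∂I. -/
theorem exists_isCollapse_unitInterval : ∃ e : unitInterval → sphereSpace.{u} 1,
    IsCollapse {x : unitInterval | 0 < x ∧ x < 1} (sphereBase 1) e :=
  exists_isCollapse (isOpen_Ioi.inter isOpen_Iio) _
    (unitIntervalInteriorHomeomorph.trans (Homeomorph.unitBall.symm.trans
      ((ContinuousLinearEquiv.ofFinrankEq (𝕜 := ℝ) (F := EuclideanSpace ℝ (Fin 1))
        (by simp)).toHomeomorph.trans (sphereComplHomeomorph 1).symm)))

/-- The homeomorphism `ℝ × ℝⁿ ≅ ℝⁿ⁺¹`. -/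
noncomputable def euclideanProdHomeomorph (n : ℕ) :
    EuclideanSpace ℝ (Fin 1) × EuclideanSpace ℝ (Fin n) ≃ₜ EuclideanSpace ℝ (Fin (n + 1)) :=
  have h (m : ℕ) : T2Space (EuclideanSpace ℝ (Fin m)) := inferInstance
  have := h 1
  have := h n
  have := h (n + 1)
  (ContinuousLinearEquiv.ofFinrankEq (𝕜 := ℝ)
    (E := EuclideanSpace ℝ (Fin 1) × EuclideanSpace ℝ (Fin n))
    (by simp [Module.finrank_prod, add_comm])).toHomeomorph

/-- Away from base points the claim is ℝ × ℝ^n ≅ ℝ^{n+1}; the collapse realises S^{n+1} as S^1 ∧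
S^n. -/
theorem exists_isCollapse_sphere (n : ℕ) :
    ∃ μ : sphereSpace.{u} 1 × sphereSpace.{u} n → sphereSpace.{u} (n + 1),
      IsCollapse {p | p.1 ≠ sphereBase 1 ∧ p.2 ≠ sphereBase n} (sphereBase (n + 1)) μ :=
  exists_isCollapse (isOpen_compl_singleton.prod isOpen_compl_singleton) _
    ((Homeomorph.Set.prod {sphereBase 1}ᶜ {sphereBase n}ᶜ).trans
      (((sphereComplHomeomorph 1).prodCongr (sphereComplHomeomorph n)).trans
        ((euclideanProdHomeomorph n).trans (sphereComplHomeomorph (n + 1)).symm)))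

/-- The coordinates of the cells of `Θ_n` in the `n`-sphere. -/
theorem nonempty_cellCoords (n : ℕ) : Nonempty (CellCoords (assembly (n + 1))
    (thetaCell.{u} (n + 1)) (sphereSpace.{u} (n + 1)) (sphereBase (n + 1))) := by
  obtain ⟨e, he⟩ := exists_isCollapse_unitInterval.{u}
  induction n with
  -- Circle coordinates on simplices are both the base case Θ_1 = Δ and the Δ factor of every
  -- inductive step.
  | zero => exact ⟨he.simplexCoords⟩
  | succ n ih =>
    obtain ⟨D⟩ := ih
    obtain ⟨μ, hμ⟩ := exists_isCollapse_sphere.{u} (n + 1)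
    exact ⟨he.simplexCoords.wreath D hμ⟩

end ThetaSpaces

/-! ### The natural homeomorphism -/

theorem mainTheorem6 (n : ℕ) (hn : 1 ≤ n) :
    ∃ h : ∀ A : ThetaSpaces.GammaSpace.{u},
        ((ThetaSpaces.thetaRealization.{u} n).obj ((ThetaSpaces.assemblyPullback n).obj A)) ≃ₜ
          ((ThetaSpaces.segalSpectrumSpace.{u} n).obj A),
      ∀ (A B : ThetaSpaces.GammaSpace.{u}) (f : A ⟶ B)
        (x : (ThetaSpaces.thetaRealization.{u} n).obj ((ThetaSpaces.assemblyPullback n).obj A)),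
        h B (((ThetaSpaces.thetaRealization.{u} n).map
            ((ThetaSpaces.assemblyPullback n).map f)).hom x) =
          ((ThetaSpaces.segalSpectrumSpace.{u} n).map f).hom (h A x) := by
  obtain ⟨n, rfl⟩ := Nat.exists_eq_add_of_le' hn
  obtain ⟨D⟩ := ThetaSpaces.nonempty_cellCoords.{u} n
  exact ⟨fun A ↦ D.tensorHomeomorph A.obj, fun A B f x ↦ D.toPower_naturality f.hom x⟩
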